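/- **Corollary (3-WL expressiveness of FloydNet).** *Graphs.* Let $G=(V,\mathcal E,\mathbf G,\mathbf X,\mathbf E)$ be a finite undirected simple graph $(V,\mathcal E)$ with a graph feature $\mathbf G\in\mathbb R^{d_g}$, node features $\mathbf X_i\in\mathbb R^{d_n}$ and symmetric pair features $\mathbf E_{ij}=\mathbf E_{ji}\in\mathbb R^{d_e}$ (dimensions may be $0$; featureless graphs have all features zero). *$k$-FloydNet.* For $k$-tuples $\vec e\in V^k$ write $\vec e[i]\leftarrow p$ for $\vec e$ with its $i$-th entry replaced by $p$. A $k$-FloydNet with $h\ge 1$ heads of dimension $d_h\ge 1$ and width $d_r=h\,d_h$ computes $R^{(0)}_{\vec e}=\mathrm{MLP}(\cdot)\in\mathbb R^{d_r}$ from the concatenation of $\mathbf G$, all $\mathbf X_{v_a}$ and all $(\mathbf 1[v_av_b\in\mathcal E],\mathbf E_{v_av_b})$ with $a<b$, and then applies finitely many blocks $$R'=R^{(l-1)}+\mathrm{PivotalAttention}(\mathrm{Norm}(R^{(l-1)})),\qquad R^{(l)}=R'+\mathrm{FFN}(\mathrm{Norm}(R')),$$ with separate parameters in each block. MLPs have ReLU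 activation and any depth and widths; the FFN has one hidden ReLU layer of any width. In each head of Pivotal Attention, with linear projections $q_{\vec e}=W_QR_{\vec e}$ and, for each position $i$, $k^i=W_K^iR$, $v^i=W_V^iR$, $$k_{\vec e,p}=\mathcal C_{i}\big(k^i_{\vec e[i]\leftarrow p}\big),\quad v_{\vec e,p}=\mathcal C_{i}\big(v^i_{\vec e[i]\leftarrow p}\big),\quad o_{\vec e}=\sum_{p\in V}\operatorname{softmax}_p\!\Big(\tfrac{\langle q_{\vec e},k_{\vec e,p}\rangle}{\sqrt{d_h}}\Big)v_{\vec e,p},$$ and the heads are concatenated and projected linearly to $\mathbb R^{d_r}$. Here $\mathcal C$ is addition or entrywise multiplication, and Norm is LayerNorm, RMSNorm, or QK-Norm (the tensor is not normalised, and the query and key vectors of each head are layer-normalised), with learnable gain (and offset, for LayerNorm) and stabiliser $\varepsilon\ge 0$. *FloydNet* works on pairs: $R^{(0)}_{ij}=\mathrm{MLP}([\mathbf G,\mathbf X_i,\mathbf X_j,\mathbf 1[ij\in\mathcal E],\mathbf E_{ij}])$, and its blocks have $k_{ijk}=\mathcal C(k_{ij},k_{jk})$, $v_{ijk}=\mathcal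 C(v_{ij},v_{jk})$, where the two segments are projected by different matrices, and attention runs over the pivots $j$. *Distinguishing.* FloydNet distinguishes $G$ and $H$ if for some size and parameters the multisets of the final $R^{(L)}_{ij}$ over all ordered pairs of vertices of $G$ and of $H$ differ. $k$-FWL and $k$-WL colour each $k$-tuple initially by its isomorphism type (equalities, adjacencies and features) and refine it injectively by $$C'_{\vec e}=\big(C_{\vec e},\{\!\{(C_{\vec e[1]\leftarrow p},\dots,C_{\vec e[k]\leftarrow p}):p\in V\}\!\}\big)\quad\text{and}\quad C'_{\vec e}=\big(C_{\vec e},(\{\!\{C_{\vec e[i]\leftarrow p}:p\in V\}\!\})_{i\le k}\big)$$ respectively; $1$-WL colours each vertex initially by its node feature and the graph feature and refines by $C'_i=(C_i,\{\!\{(\mathbf E_{ij},C_j):j\sim i\}\!\})$. A test distinguishes $G$ and $H$ if after some number of rounds the multisets of colours differ. An MPNN updates node states by $h_i'=U\big(h_i,\mathrm{AGG}\{\!\{M(h_i,h_j,\mathbf E_{ij}):j\sim i\}\!\}\big)$ with arbitrary layer-dependent functions $U,\mathrm{AGG},M$, starting from an arbitrary function of $(\mathbf G,\mathbf X_i)$;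 MPNNs distinguish $G$ and $H$ if for some MPNN the multisets of final node states differ. *Statement.* For every choice of $\mathcal C$, Norm and $\varepsilon$ and all $d_n,d_e,d_g$: 1. FloydNet is the case $k=2$ of $k$-FloydNet: with the same parameters both have the same final representation of every pair. 2. For all $G,H$ as above: FloydNet distinguishes $G$ and $H$ $\iff$ $2$-FWL does $\iff$ $3$-WL does. 3. If some MPNN distinguishes $G$ and $H$, then $1$-WL does; if $1$-WL does, then FloydNet does. This is strict: there are two featureless graphs with the same number of vertices that FloydNet distinguishes, but neither $1$-WL nor any MPNN does. -/

import Mathlib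

universe u v

open scoped Matrix

noncomputable section

namespace FloydNet

/-- Real feature vectors with `d` coordinates. -/
abbrev Vec (d : ℕ) : Type := Fin d → ℝ

/-! ### Input graphs -/

/-- An undirected graph on `V` with a graph feature, node features and (symmetric) pair features. -/
structure FeaturedGraph (V : Type u) (dn de dg : ℕ) where
  graph : SimpleGraph V
  graphFeat : Vec dg
  nodeFeat : V → Vec dn
  edgeFeat : V → V → Vec de
  edgeFeat_symm : ∀ i j, edgeFeat i j = edgeFeat j i

/-- A simple graph without features (all features are zero). -/
def FeaturedGraph.plain {V : Type u} (S : SimpleGraph V) (dn de dg : ℕ) :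
    FeaturedGraph V dn de dg where
  graph := S
  graphFeat := 0
  nodeFeat := fun _ => 0
  edgeFeat := fun _ _ => 0
  edgeFeat_symm := fun _ _ => rfl

open Classical in
/-- The edge feature `E i j` that a network reads: the entry of the adjacency matrix (coordinate
`none`), followed by the coordinates of the given pair feature. -/
def FeaturedGraph.pairInput {V : Type u} {dn de dg : ℕ} (G : FeaturedGraph V dn de dg) (i j : V) :
    Option (Fin de) → ℝ
  | none => if G.graph.Adj i j then 1 else 0
  | some c => G.edgeFeat i j c

/-! ### Weisfeiler-Leman tests

Hashing is represented by its free version: the colour after `t + 1` rounds is the pair of data that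
would be hashed, so that "injective hash" holds by construction, and colours of different graphs can
be compared. -/

/-- Isomorphism types of ordered `k`-tuples of vertices. -/
structure AtomicType (k dn de dg : ℕ) where
  graphFeat : Vec dg
  nodeFeat : Fin k → Vec dn
  eq : Fin k → Fin k → Prop
  adj : Fin k → Fin k → Prop
  edgeFeat : Fin k → Fin k → Vec de

/-- The isomorphism type of the tuple `e` in `G`. -/
def atomicType {V : Type u} {k dn de dg : ℕ} (G : FeaturedGraph V dn de dg) (e : Fin k → V) :
    AtomicType k dn de dg where
  graphFeat := G.graphFeat
  nodeFeat := fun a => G.nodeFeat (e a)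
  eq := fun a b => e a = e b
  adj := fun a b => G.graph.Adj (e a) (e b)
  edgeFeat := fun a b => G.edgeFeat (e a) (e b)

/-- Colours of `k`-FWL after `t` rounds, over a type `A` of initial colours. -/
def FWLColor (A : Type) (k : ℕ) : ℕ → Type
  | 0 => A
  | t + 1 => FWLColor A k t × Multiset (Fin k → FWLColor A k t)

/-- Colours of `k`-WL after `t` rounds, over a type `A` of initial colours. -/
def WLColor (A : Type) (k : ℕ) : ℕ → Type
  | 0 => A
  | t + 1 => WLColor A k t × (Fin k → Multiset (WLColor A k t))

open Classical in
/-- `k`-FWL: the new colour of `e` is its old colour together with the multiset over pivots `p` of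
the ordered tuple of the colours of `e[1] ← p, …, e[k] ← p`. -/
def fwlColor {V : Type u} [Fintype V] {dn de dg : ℕ} (G : FeaturedGraph V dn de dg) (k : ℕ) :
    (t : ℕ) → (Fin k → V) → FWLColor (AtomicType k dn de dg) k t
  | 0, e => atomicType G e
  | t + 1, e => (fwlColor G k t e,
      (Finset.univ : Finset V).val.map fun p i => fwlColor G k t (Function.update e i p))

open Classical in
/-- `k`-WL (for `2 ≤ k`): the new colour of `e` is its old colour together with, for each position
`i`, the multiset over pivots `p` of the colours of `e[i] ← p`. -/
def wlColor {V : Type u} [Fintype V] {dn de dg : ℕ} (G : FeaturedGraph V dn de dg) (k : ℕ) :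
    (t : ℕ) → (Fin k → V) → WLColor (AtomicType k dn de dg) k t
  | 0, e => atomicType G e
  | t + 1, e => (wlColor G k t e, fun i =>
      (Finset.univ : Finset V).val.map fun p => wlColor G k t (Function.update e i p))

open Classical in
/-- `k`-FWL distinguishes `G` and `H`: after some number of rounds the multisets of colours of all
`k`-tuples differ. -/
def FWLDistinguishes (k : ℕ) {V : Type u} {W : Type v} [Fintype V] [Fintype W] {dn de dg : ℕ}
    (G : FeaturedGraph V dn de dg) (H : FeaturedGraph W dn de dg) : Prop :=
  ∃ t : ℕ, (Finset.univ : Finset (Fin k → V)).val.map (fwlColor G k t) ≠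
    (Finset.univ : Finset (Fin k → W)).val.map (fwlColor H k t)

open Classical in
/-- `k`-WL (for `2 ≤ k`) distinguishes `G` and `H`. -/
def WLDistinguishes (k : ℕ) {V : Type u} {W : Type v} [Fintype V] [Fintype W] {dn de dg : ℕ}
    (G : FeaturedGraph V dn de dg) (H : FeaturedGraph W dn de dg) : Prop :=
  ∃ t : ℕ, (Finset.univ : Finset (Fin k → V)).val.map (wlColor G k t) ≠
    (Finset.univ : Finset (Fin k → W)).val.map (wlColor H k t)

/-- Colours of `1`-WL (colour refinement) after `t` rounds. -/
def OneWLColor (dn de dg : ℕ) : ℕ → Type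
  | 0 => Vec dg × Vec dn
  | t + 1 => OneWLColor dn de dg t × Multiset (Vec de × OneWLColor dn de dg t)

open Classical in
/-- `1`-WL: the new colour of a vertex is its old colour together with the multiset of the edge
features and colours of its neighbours. -/
def oneWLColor {V : Type u} [Fintype V] {dn de dg : ℕ} (G : FeaturedGraph V dn de dg) :
    (t : ℕ) → V → OneWLColor dn de dg t
  | 0, i => (G.graphFeat, G.nodeFeat i)
  | t + 1, i => (oneWLColor G t i,
      (G.graph.neighborFinset i).val.map fun j => (G.edgeFeat i j, oneWLColor G t j))

/-- `1`-WL distinguishes `G` and `H`. -/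
def OneWLDistinguishes {V : Type u} {W : Type v} [Fintype V] [Fintype W] {dn de dg : ℕ}
    (G : FeaturedGraph V dn de dg) (H : FeaturedGraph W dn de dg) : Prop :=
  ∃ t : ℕ, (Finset.univ : Finset V).val.map (oneWLColor G t) ≠
    (Finset.univ : Finset W).val.map (oneWLColor H t)

/-! ### Message passing networks -/

/-- A message passing network with `depth` layers: arbitrary message and update functions and an
arbitrary aggregation of the multiset of incoming messages. -/
structure MPNN (dn de dg : ℕ) where
  width : ℕ
  messageWidth : ℕ
  depth : ℕ
  start : Vec dg → Vec dn → Vec width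
  message : ℕ → Vec width → Vec width → Vec de → Vec messageWidth
  aggregate : ℕ → Multiset (Vec messageWidth) → Vec messageWidth
  update : ℕ → Vec width → Vec messageWidth → Vec width

open Classical in
/-- The state of a node after `l` layers. -/
def MPNN.state {V : Type u} [Fintype V] {dn de dg : ℕ} (M : MPNN dn de dg)
    (G : FeaturedGraph V dn de dg) : ℕ → V → Vec M.width
  | 0, i => M.start G.graphFeat (G.nodeFeat i)
  | l + 1, i => M.update l (M.state G l i) (M.aggregate l
      ((G.graph.neighborFinset i).val.map fun j =>
        M.message l (M.state G l i) (M.state G l j) (G.edgeFeat i j)))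

/-- Some message passing network yields different multisets of final node states. -/
def MPNNDistinguishes {V : Type u} {W : Type v} [Fintype V] [Fintype W] {dn de dg : ℕ}
    (G : FeaturedGraph V dn de dg) (H : FeaturedGraph W dn de dg) : Prop :=
  ∃ M : MPNN dn de dg, (Finset.univ : Finset V).val.map (M.state G M.depth) ≠
    (Finset.univ : Finset W).val.map (M.state H M.depth)

/-! ### Building blocks of FloydNet -/

/-- The rectifier, coordinatewise. -/
def relu {d : ℕ} (x : Vec d) : Vec d := fun i => max 0 (x i)

/-- Multilayer perceptrons with inputs indexed by `ι`, outputs in `Vec n`, arbitrary depth and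
arbitrary hidden widths. -/
inductive MLP (n : ℕ) : Type → Type 1
  | affine {ι : Type} (A : Matrix (Fin n) ι ℝ) (b : Vec n) : MLP n ι
  | layer {ι : Type} {m : ℕ} (A : Matrix (Fin m) ι ℝ) (b : Vec m) (rest : MLP n (Fin m)) : MLP n ι

/-- The function computed by a multilayer perceptron. -/
def MLP.eval {n : ℕ} : {ι : Type} → [Fintype ι] → MLP n ι → (ι → ℝ) → Vec n
  | _, _, .affine A b, x => A *ᵥ x + b
  | _, _, .layer A b rest, x => rest.eval (relu (A *ᵥ x + b))

/-- Learnable gain and offset of a normalisation. -/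
structure NormParams (d : ℕ) where
  gain : Vec d
  offset : Vec d

/-- LayerNorm with stabiliser `ε`. -/
def layerNorm {d : ℕ} (ε : ℝ) (P : NormParams d) (x : Vec d) : Vec d :=
  let mean : ℝ := (∑ j, x j) / d
  let var : ℝ := (∑ j, (x j - mean) ^ 2) / d
  fun i => P.gain i * ((x i - mean) / Real.sqrt (var + ε)) + P.offset i

/-- RMSNorm with stabiliser `ε` (a gain, but no offset). -/
def rmsNorm {d : ℕ} (ε : ℝ) (P : NormParams d) (x : Vec d) : Vec d :=
  fun i => P.gain i * (x i / Real.sqrt ((∑ j, (x j) ^ 2) / d + ε))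

/-- The choice of normalisation. -/
inductive NormKind
  | layer
  | rms
  | qk

/-- The choice of the operation that combines keys, and values, along a path. -/
inductive CombineKind
  | add
  | mul

/-- The design choices of the architecture. -/
structure Config where
  norm : NormKind
  combine : CombineKind
  eps : ℝ
  eps_nonneg : 0 ≤ eps

/-- The normalisation of the relationship tensor in front of each sublayer. With QK-Norm the tensor
itself is passed on unchanged, and queries and keys are normalised instead. -/
def Config.blockNorm (cfg : Config) {d : ℕ} (P : NormParams d) (x : Vec d) : Vec d :=
  match cfg.norm with
  | .layer => layerNorm cfg.eps P x
  | .rms => rmsNorm cfg.eps P x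
  | .qk => x

/-- The normalisation of the query and key vectors of a head: LayerNorm for QK-Norm, and none
otherwise. -/
def Config.headNorm (cfg : Config) {d : ℕ} (P : NormParams d) (x : Vec d) : Vec d :=
  match cfg.norm with
  | .layer => x
  | .rms => x
  | .qk => layerNorm cfg.eps P x

/-- The combine operation on a family of vectors. -/
def Config.combineAll (cfg : Config) {d k : ℕ} (x : Fin k → Vec d) : Vec d :=
  match cfg.combine with
  | .add => ∑ i, x i
  | .mul => ∏ i, x i

/-- The combine operation on two vectors. -/
def Config.combineTwo (cfg : Config) {d : ℕ} (x y : Vec d) : Vec d :=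
  match cfg.combine with
  | .add => x + y
  | .mul => x * y

/-- Scaled dot-product attention of one head: softmax over the pivots `p : V`. -/
def attend {V : Type u} [Fintype V] {d : ℕ} (q : Vec d) (key val : V → Vec d) : Vec d :=
  let score : V → ℝ := fun p => (q ⬝ᵥ key p) / Real.sqrt d
  ∑ p, (Real.exp (score p) / ∑ p', Real.exp (score p')) • val p

/-- The parameters of a block of `k`-FloydNet with `h` heads of dimension `dh`; the width of the
relationship tensor is `h * dh`. Keys and values have a projection for each position `i : Fin k`. -/
structure Block (k h dh : ℕ) where
  normAttention : NormParams (h * dh)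
  normFeedForward : NormParams (h * dh)
  normQuery : NormParams dh
  normKey : NormParams dh
  query : Fin h → Matrix (Fin dh) (Fin (h * dh)) ℝ
  key : Fin k → Fin h → Matrix (Fin dh) (Fin (h * dh)) ℝ
  value : Fin k → Fin h → Matrix (Fin dh) (Fin (h * dh)) ℝ
  output : Matrix (Fin (h * dh)) (Fin h × Fin dh) ℝ
  hidden : ℕ
  ffnIn : Matrix (Fin hidden) (Fin (h * dh)) ℝ
  ffnInBias : Vec hidden
  ffnOut : Matrix (Fin (h * dh)) (Fin hidden) ℝ
  ffnOutBias : Vec (h * dh)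

/-- The feed-forward network of a block. -/
def Block.feedForward {k h dh : ℕ} (B : Block k h dh) (x : Vec (h * dh)) : Vec (h * dh) :=
  B.ffnOut *ᵥ relu (B.ffnIn *ᵥ x + B.ffnInBias) + B.ffnOutBias

/-- Positions of the concatenation of the features of order at most two of a `k`-tuple
`(v₁, …, v_k)`: the graph feature, the node features of all `v_a`, and the edge features of all
`(v_a, v_b)` with `a < b`. For `k = 2` these are the positions of `[G, X_i, X_j, E_ij]`. -/
abbrev InputIndex (k dn de dg : ℕ) : Type :=
  Fin dg ⊕ ((Fin k × Fin dn) ⊕ ({ab : Fin k × Fin k // ab.1 < ab.2} × Option (Fin de)))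

/-- A `k`-FloydNet: an initial perceptron and a stack of blocks. -/
structure Net (k dn de dg : ℕ) where
  heads : ℕ
  headDim : ℕ
  heads_pos : 0 < heads
  headDim_pos : 0 < headDim
  start : MLP (heads * headDim) (InputIndex k dn de dg)
  blocks : List (Block k heads headDim)

/-! ### `k`-FloydNet -/

/-- The concatenation of the features of order at most two of the tuple `e`. -/
def tupleInput {V : Type u} {k dn de dg : ℕ} (G : FeaturedGraph V dn de dg) (e : Fin k → V) :
    InputIndex k dn de dg → ℝ
  | .inl c => G.graphFeat c
  | .inr (.inl (a, c)) => G.nodeFeat (e a) c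
  | .inr (.inr (ab, c)) => G.pairInput (e ab.1.1) (e ab.1.2) c

open Classical in
/-- Pivotal Attention on `k`-tuples. -/
def Block.tupleAttention {V : Type u} [Fintype V] {k h dh : ℕ} (cfg : Config) (B : Block k h dh)
    (R : (Fin k → V) → Vec (h * dh)) (e : Fin k → V) : Vec (h * dh) :=
  B.output *ᵥ fun hc : Fin h × Fin dh =>
    attend (cfg.headNorm B.normQuery (B.query hc.1 *ᵥ R e))
      (fun p : V => cfg.combineAll fun i =>
        cfg.headNorm B.normKey (B.key i hc.1 *ᵥ R (Function.update e i p)))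
      (fun p : V => cfg.combineAll fun i => B.value i hc.1 *ᵥ R (Function.update e i p))
      hc.2

/-- A block of `k`-FloydNet, with residual connections. -/
def Block.tupleApply {V : Type u} [Fintype V] {k h dh : ℕ} (cfg : Config) (B : Block k h dh)
    (R : (Fin k → V) → Vec (h * dh)) : (Fin k → V) → Vec (h * dh) :=
  let R' : (Fin k → V) → Vec (h * dh) := fun e =>
    R e + B.tupleAttention cfg (fun e' => cfg.blockNorm B.normAttention (R e')) e
  fun e => R' e + B.feedForward (cfg.blockNorm B.normFeedForward (R' e))

/-- The final relationship tensor of a `k`-FloydNet. -/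
def Net.tupleRep {V : Type u} [Fintype V] {k dn de dg : ℕ} (cfg : Config) (N : Net k dn de dg)
    (G : FeaturedGraph V dn de dg) : (Fin k → V) → Vec (N.heads * N.headDim) :=
  N.blocks.foldl (fun R B => B.tupleApply cfg R) fun e => N.start.eval (tupleInput G e)

/-! ### FloydNet -/

/-- The concatenation `[g, x, y, z]`. -/
def concatInput {dn de dg : ℕ} (g : Vec dg) (x y : Vec dn) (z : Option (Fin de) → ℝ) :
    InputIndex 2 dn de dg → ℝ
  | .inl c => g c
  | .inr (.inl (a, c)) => if a = 0 then x c else y c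
  | .inr (.inr (_, c)) => z c

/-- Pivotal Attention on pairs: `(i, k)` attends to the paths `i ⇝ j ⇝ k`, and the keys (values) of
`(i, j)` and `(j, k)`, which are obtained by different projections, are combined. -/
def Block.pairAttention {V : Type u} [Fintype V] {h dh : ℕ} (cfg : Config) (B : Block 2 h dh)
    (R : V → V → Vec (h * dh)) (i k : V) : Vec (h * dh) :=
  B.output *ᵥ fun hc : Fin h × Fin dh =>
    attend (cfg.headNorm B.normQuery (B.query hc.1 *ᵥ R i k))
      (fun j : V => cfg.combineTwo
        (cfg.headNorm B.normKey (B.key 1 hc.1 *ᵥ R i j))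
        (cfg.headNorm B.normKey (B.key 0 hc.1 *ᵥ R j k)))
      (fun j : V => cfg.combineTwo (B.value 1 hc.1 *ᵥ R i j) (B.value 0 hc.1 *ᵥ R j k))
      hc.2

/-- A FloydBlock, with residual connections. -/
def Block.pairApply {V : Type u} [Fintype V] {h dh : ℕ} (cfg : Config) (B : Block 2 h dh)
    (R : V → V → Vec (h * dh)) : V → V → Vec (h * dh) :=
  let R' : V → V → Vec (h * dh) := fun i k =>
    R i k + B.pairAttention cfg (fun i' k' => cfg.blockNorm B.normAttention (R i' k')) i k
  fun i k => R' i k + B.feedForward (cfg.blockNorm B.normFeedForward (R' i k))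

/-- The final relationship tensor of FloydNet. -/
def Net.pairRep {V : Type u} [Fintype V] {dn de dg : ℕ} (cfg : Config) (N : Net 2 dn de dg)
    (G : FeaturedGraph V dn de dg) : V → V → Vec (N.heads * N.headDim) :=
  N.blocks.foldl (fun R B => B.pairApply cfg R) fun i j =>
    N.start.eval (concatInput G.graphFeat (G.nodeFeat i) (G.nodeFeat j) (G.pairInput i j))

/-- FloydNet, with design choices `cfg`, distinguishes `G` and `H`: for some choice of size and
parameters the multisets of final pair representations differ. -/
def FloydNetDistinguishes (cfg : Config) {V : Type u} {W : Type v} [Fintype V] [Fintype W]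
    {dn de dg : ℕ} (G : FeaturedGraph V dn de dg) (H : FeaturedGraph W dn de dg) : Prop :=
  ∃ N : Net 2 dn de dg,
    (Finset.univ : Finset (V × V)).val.map (fun e => N.pairRep cfg G e.1 e.2) ≠
      (Finset.univ : Finset (W × W)).val.map (fun e => N.pairRep cfg H e.1 e.2)

end FloydNet

end

noncomputable section

namespace FloydNet

/-! ### Finite multisets of colours and bijections -/

/-! Agreement of refined colours in every round is a bisimulation: equal multisets give a bijection
of pivots in each round, and as there are finitely many bijections, one works for all rounds
(`Indist.exists_equiv`). Conversely, a relation closed under such replies relates only tuples with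
equal colours (`indist_of_bisimulation`), as in the bijective pebble game.

Upper bound: softmax attention is a ratio of sums over pivots, hence unchanged by a bijection of
pivots that preserves the representations. So every representation depends only on the stable 2-FWL
colour.

Lower bound: code the finitely many colours that occur as one-hot vectors. One round of refinement
needs the number `N a b` of pivots whose two segments have colours `a` and `b`. With multiplication,
uniform attention reads these numbers off directly; with addition, it yields only row and column
sums, and one further head for each colour, with non-uniform scores, recovers the table
(`Config.exists_countingAttention`). A linear functional compresses the table into one spare
coordinate, and the FFN interpolates the update on the finitely many possible inputs
(`exists_block`). Constant entries `1` and `0` in every code keep the normalisations injective.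

This simulates refinement from the network inputs, which do not record whether `i = j`. The gap is
closed by twins, vertices with identical input rows: exchanging twins preserves all colours, so
pebble replies can be corrected to respect equality (`InputIndist.exists_equiv_apply`).

For 2-FWL against 3-WL, two triples are equivalent exactly when their pairs are: moving one of three
pebbles leaves a pair, and a pair in a triple leaves one position free for a pivot. An MPNN state is
a function of the 1-WL colour, and 1-WL colours are determined by the diagonal pair colours. The
six-cycle and two triangles are both 2-regular, but only one has a triangle. -/

theorem exists_equiv_of_map_univ_eq {α : Type u} {β : Type v} {γ : Type*} [Fintype α] [Fintype β]
    {f : α → γ} {g : β → γ}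
    (h : (Finset.univ : Finset α).val.map f = (Finset.univ : Finset β).val.map g) :
    ∃ σ : α ≃ β, ∀ a, f a = g (σ a) := by
  classical
  have key : ∀ c, Nonempty ({a // f a = c} ≃ {b // g b = c}) := by
    intro c
    have h' := congrArg (Multiset.count c) h
    rw [Multiset.count_map, Multiset.count_map] at h'
    refine ⟨Fintype.equivOfCardEq ?_⟩
    rw [Fintype.card_subtype, Fintype.card_subtype]
    simpa [Finset.card, eq_comm] using h'
  exact ⟨Equiv.ofFiberEquiv fun c => (key c).some, fun a => (Equiv.ofFiberEquiv_map _ a).symm⟩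

theorem map_univ_eq_of_equiv {α : Type u} {β : Type v} {γ : Type*} [Fintype α] [Fintype β]
    {f : α → γ} {g : β → γ} (σ : α ≃ β) (h : ∀ a, f a = g (σ a)) :
    (Finset.univ : Finset α).val.map f = (Finset.univ : Finset β).val.map g := by
  rw [← Multiset.map_univ_val_equiv σ, Multiset.map_map]
  exact Multiset.map_congr rfl fun a _ => h a

/-- A bijection of products that respects colours of the first coordinate yields a bijection of the
first factors that respects colours. -/
theorem exists_equiv_fst {α β X Y : Type*} {γ : Type*} [Fintype α] [Fintype β] [Fintype X]
    [Fintype Y] [Nonempty X] (hXY : Fintype.card X = Fintype.card Y) {f : α → γ} {g : β → γ}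
    (τ : α × X ≃ β × Y) (h : ∀ e, f e.1 = g (τ e).1) :
    ∃ ρ : α ≃ β, ∀ a, f a = g (ρ a) := by
  classical
  have key : ∀ c, Nonempty ({a // f a = c} ≃ {b // g b = c}) := by
    intro c
    refine ⟨Fintype.equivOfCardEq ?_⟩
    -- A fibre of `f` times `X` is a fibre of `f ∘ Prod.fst`, which `τ` matches with the
    -- corresponding one for `g`. The common factor `|X| = |Y| > 0` then cancels.
    have e₁ : {a // f a = c} × X ≃ {e : α × X // f e.1 = c} :=
      { toFun := fun x => ⟨(x.1.1, x.2), x.1.2⟩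
        invFun := fun x => (⟨x.1.1, x.2⟩, x.1.2)
        left_inv := fun _ => rfl
        right_inv := fun _ => rfl }
    have e₂ : {b // g b = c} × Y ≃ {e : β × Y // g e.1 = c} :=
      { toFun := fun x => ⟨(x.1.1, x.2), x.1.2⟩
        invFun := fun x => (⟨x.1.1, x.2⟩, x.1.2)
        left_inv := fun _ => rfl
        right_inv := fun _ => rfl }
    have e₃ : {e : α × X // f e.1 = c} ≃ {e : β × Y // g e.1 = c} :=
      τ.subtypeEquiv fun e => by rw [h e]
    have := Fintype.card_congr (e₁.trans (e₃.trans e₂.symm))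
    rw [Fintype.card_prod, Fintype.card_prod, ← hXY] at this
    exact Nat.eq_of_mul_eq_mul_right Fintype.card_pos this
  exact ⟨Equiv.ofFiberEquiv fun c => (key c).some, fun a => (Equiv.ofFiberEquiv_map _ a).symm⟩

/-- Compactness for a decreasing sequence of nonempty subsets of a finite type: if each `i` failed
at some round, all would fail at the largest of these rounds. -/
theorem exists_forall_of_succ_imp {ι : Type*} [Finite ι] {P : ℕ → ι → Prop}
    (hP : ∀ t i, P (t + 1) i → P t i) (h : ∀ t, ∃ i, P t i) : ∃ i, ∀ t, P t i := by
  classical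
  cases nonempty_fintype ι
  by_contra! hc
  choose t ht using hc
  obtain ⟨i, hi⟩ := h (Finset.univ.sup t)
  have mono : ∀ a b, a ≤ b → P b i → P a i := by
    intro a b hab
    induction hab with
    | refl => exact id
    | step _ ih => exact fun hb => ih (hP _ _ hb)
  exact ht i (mono _ _ (Finset.le_sup (Finset.mem_univ i)) hi)

/-! ### Folklore refinement of arbitrary initial colourings -/

section Refine

variable {V : Type u} {W : Type v} [Fintype V] [Fintype W] {A : Type} {k : ℕ}

/-- Folklore refinement starting from an arbitrary colouring of `k`-tuples. -/
def refine (c : (Fin k → V) → A) : (t : ℕ) → (Fin k → V) → FWLColor A k t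
  | 0, e => c e
  | t + 1, e => (refine c t e,
      (Finset.univ : Finset V).val.map fun p i => refine c t (Function.update e i p))

theorem fwlColor_eq_refine {dn de dg : ℕ} (G : FeaturedGraph V dn de dg) (t : ℕ) :
    fwlColor G k t = refine (atomicType G) t := by
  induction t with
  | zero => rfl
  | succ t ih =>
    funext e
    simp only [fwlColor, refine, ih]
    rfl

/-- Tuples with the same refined colour after every number of rounds. -/
def Indist (c : (Fin k → V) → A) (d : (Fin k → W) → A) (e : Fin k → V) (e' : Fin k → W) : Prop :=
  ∀ t, refine c t e = refine d t e'

variable {c : (Fin k → V) → A} {d : (Fin k → W) → A}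

theorem Indist.init {e : Fin k → V} {e' : Fin k → W} (h : Indist c d e e') : c e = d e' := h 0

theorem Indist.trans {U : Type*} [Fintype U] {b : (Fin k → U) → A} {e : Fin k → V}
    {e' : Fin k → W} {e'' : Fin k → U} (h : Indist c d e e') (h' : Indist d b e' e'') :
    Indist c b e e'' :=
  fun t => (h t).trans (h' t)

theorem refine_eq_of_succ {t : ℕ} {e : Fin k → V} {e' : Fin k → W}
    (h : refine c (t + 1) e = refine d (t + 1) e') : refine c t e = refine d t e' :=
  congrArg Prod.fst h

/-- The reply in the bijective pebble game. Each round supplies a bijection; a bijection good for a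
later round is good for earlier ones, and `V ≃ W` is finite. -/
theorem Indist.exists_equiv {e : Fin k → V} {e' : Fin k → W} (h : Indist c d e e') :
    ∃ σ : V ≃ W, ∀ p i, Indist c d (Function.update e i p) (Function.update e' i (σ p)) := by
  classical
  obtain ⟨σ, hσ⟩ := exists_forall_of_succ_imp
    (P := fun t (σ : V ≃ W) => ∀ p i,
      refine c t (Function.update e i p) = refine d t (Function.update e' i (σ p)))
    (fun t σ hs p i => refine_eq_of_succ (hs p i))
    (fun t => by
      obtain ⟨σ, hσ⟩ := exists_equiv_of_map_univ_eq (congrArg Prod.snd (h (t + 1)))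
      exact ⟨σ, fun p i => congrFun (hσ p) i⟩)
  exact ⟨σ, fun p i t => hσ t p i⟩

theorem exists_equiv_indist
    (h : ∀ t, (Finset.univ : Finset (Fin k → V)).val.map (refine c t) =
      (Finset.univ : Finset (Fin k → W)).val.map (refine d t)) :
    ∃ τ : (Fin k → V) ≃ (Fin k → W), ∀ e, Indist c d e (τ e) := by
  classical
  obtain ⟨τ, hτ⟩ := exists_forall_of_succ_imp
    (P := fun t (τ : (Fin k → V) ≃ (Fin k → W)) => ∀ e, refine c t e = refine d t (τ e))
    (fun t τ hs e => refine_eq_of_succ (hs e))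
    (fun t => exists_equiv_of_map_univ_eq (h t))
  exact ⟨τ, fun e t => hτ t e⟩

/-- A relation that is preserved by the moves of the bijective pebble game relates only tuples with
the same refined colours. -/
theorem indist_of_bisimulation (Z : (Fin k → V) → (Fin k → W) → Prop)
    (h₀ : ∀ e e', Z e e' → c e = d e')
    (hs : ∀ e e', Z e e' → ∃ σ : V ≃ W, ∀ p i,
      Z (Function.update e i p) (Function.update e' i (σ p)))
    {e : Fin k → V} {e' : Fin k → W} (h : Z e e') : Indist c d e e' := by
  intro t
  induction t generalizing e e' with
  | zero => exact h₀ _ _ h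
  | succ t ih =>
    obtain ⟨σ, hσ⟩ := hs _ _ h
    refine Prod.ext (ih h) (map_univ_eq_of_equiv σ fun p => ?_)
    funext i
    exact ih (hσ p i)

end Refine

/-! ### Refinement of colourings of pairs -/

section Pairs

variable {V : Type u} {W : Type v} [Fintype V] [Fintype W] {A : Type}

theorem update_pair_zero {X : Type*} (i j p : X) : Function.update ![i, j] 0 p = ![p, j] := by
  ext a; fin_cases a <;> rfl

theorem update_pair_one {X : Type*} (i j p : X) : Function.update ![i, j] 1 p = ![i, p] := by
  ext a; fin_cases a <;> rfl

theorem eq_pair {X : Type*} (e : Fin 2 → X) : e = ![e 0, e 1] := by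
  ext a; fin_cases a <;> rfl

variable {c : (Fin 2 → V) → A} {d : (Fin 2 → W) → A}

theorem Indist.exists_equiv_pair {i j : V} {i' j' : W} (h : Indist c d ![i, j] ![i', j']) :
    ∃ σ : V ≃ W, ∀ p, Indist c d ![i, p] ![i', σ p] ∧ Indist c d ![p, j] ![σ p, j'] := by
  obtain ⟨σ, hσ⟩ := h.exists_equiv
  refine ⟨σ, fun p => ⟨?_, ?_⟩⟩
  · simpa only [update_pair_one] using hσ p 1
  · simpa only [update_pair_zero] using hσ p 0

theorem indist_of_pair_bisimulation (Z : V → V → W → W → Prop)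
    (h₀ : ∀ i j i' j', Z i j i' j' → c ![i, j] = d ![i', j'])
    (hs : ∀ i j i' j', Z i j i' j' → ∃ σ : V ≃ W, ∀ p, Z i p i' (σ p) ∧ Z p j (σ p) j')
    {i j : V} {i' j' : W} (h : Z i j i' j') : Indist c d ![i, j] ![i', j'] := by
  refine indist_of_bisimulation (fun e e' => Z (e 0) (e 1) (e' 0) (e' 1)) ?_ ?_ h
  · intro e e' hZ
    rw [eq_pair e, eq_pair e']
    exact h₀ _ _ _ _ hZ
  · intro e e' hZ
    obtain ⟨σ, hσ⟩ := hs _ _ _ _ hZ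
    refine ⟨σ, fun p i => ?_⟩
    fin_cases i
    · simpa using (hσ p).2
    · simpa using (hσ p).1

/-- The reversed relation is again a bisimulation: the same bijection serves, with the two segments
exchanged. -/
theorem Indist.swap (hcd : ∀ i j i' j', c ![i, j] = d ![i', j'] → c ![j, i] = d ![j', i'])
    {i j : V} {i' j' : W} (h : Indist c d ![i, j] ![i', j']) : Indist c d ![j, i] ![j', i'] := by
  refine indist_of_pair_bisimulation (fun i j i' j' => Indist c d ![j, i] ![j', i']) ?_ ?_ h
  · intro i j i' j' hZ
    exact hcd _ _ _ _ hZ.init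
  · intro i j i' j' hZ
    obtain ⟨σ, hσ⟩ := hZ.exists_equiv_pair
    exact ⟨σ, fun p => ⟨(hσ p).2, (hσ p).1⟩⟩

end Pairs

/-! ### Initial colours -/

section Initial

variable {V : Type u} {W : Type v} {dn de dg k : ℕ}
  {G : FeaturedGraph V dn de dg} {H : FeaturedGraph W dn de dg}

theorem atomicType_eq_iff {e : Fin k → V} {e' : Fin k → W} :
    atomicType G e = atomicType H e' ↔
      G.graphFeat = H.graphFeat ∧ (∀ a, G.nodeFeat (e a) = H.nodeFeat (e' a)) ∧
      (∀ a b, e a = e b ↔ e' a = e' b) ∧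
      (∀ a b, G.graph.Adj (e a) (e b) ↔ H.graph.Adj (e' a) (e' b)) ∧
      ∀ a b, G.edgeFeat (e a) (e b) = H.edgeFeat (e' a) (e' b) := by
  simp only [atomicType, AtomicType.mk.injEq, funext_iff, eq_iff_iff]

theorem pairInput_eq_iff {i j : V} {i' j' : W} :
    G.pairInput i j = H.pairInput i' j' ↔
      (G.graph.Adj i j ↔ H.graph.Adj i' j') ∧ G.edgeFeat i j = H.edgeFeat i' j' := by
  constructor
  · intro h
    refine ⟨?_, funext fun a => congrFun h (some a)⟩
    have h' := congrFun h none
    simp only [FeaturedGraph.pairInput] at h'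
    by_cases h₁ : G.graph.Adj i j <;> by_cases h₂ : H.graph.Adj i' j' <;> simp_all
  · rintro ⟨h₁, h₂⟩
    funext a
    cases a with
    | none => by_cases h : H.graph.Adj i' j' <;> simp [FeaturedGraph.pairInput, h₁, h]
    | some a => exact congrFun h₂ a

theorem tupleInput_eq_iff {e : Fin k → V} {e' : Fin k → W} :
    tupleInput G e = tupleInput H e' ↔
      G.graphFeat = H.graphFeat ∧ (∀ a, G.nodeFeat (e a) = H.nodeFeat (e' a)) ∧
      ∀ a b, a < b → (G.graph.Adj (e a) (e b) ↔ H.graph.Adj (e' a) (e' b)) ∧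
        G.edgeFeat (e a) (e b) = H.edgeFeat (e' a) (e' b) := by
  constructor
  · intro h
    refine ⟨funext fun x => congrFun h (.inl x),
      fun a => funext fun x => congrFun h (.inr (.inl (a, x))), fun a b hab => ?_⟩
    exact pairInput_eq_iff.1 (funext fun x => congrFun h (.inr (.inr (⟨(a, b), hab⟩, x))))
  · rintro ⟨h₁, h₂, h₃⟩
    funext x
    match x with
    | .inl x => exact congrFun h₁ x
    | .inr (.inl (a, x)) => exact congrFun (h₂ a) x
    | .inr (.inr (ab, x)) => exact congrFun (pairInput_eq_iff.2 (h₃ _ _ ab.2)) x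

theorem tupleInput_pair_eq_iff {i j : V} {i' j' : W} :
    tupleInput G ![i, j] = tupleInput H ![i', j'] ↔
      G.graphFeat = H.graphFeat ∧ G.nodeFeat i = H.nodeFeat i' ∧ G.nodeFeat j = H.nodeFeat j' ∧
      (G.graph.Adj i j ↔ H.graph.Adj i' j') ∧ G.edgeFeat i j = H.edgeFeat i' j' := by
  rw [tupleInput_eq_iff]
  constructor
  · rintro ⟨h₁, h₂, h₃⟩
    exact ⟨h₁, h₂ 0, h₂ 1, h₃ 0 1 (by decide)⟩
  · rintro ⟨h₁, h₂, h₃, h₄⟩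
    refine ⟨h₁, fun a => by fin_cases a <;> assumption, fun a b hab => ?_⟩
    fin_cases a <;> fin_cases b <;> first | exact h₄ | exact absurd hab (by decide)

/-- Isolates what the isomorphism type of a pair records beyond the network input; the reversed
entries come from symmetry. -/
theorem atomicType_pair_eq_iff {i j : V} {i' j' : W} :
    atomicType G ![i, j] = atomicType H ![i', j'] ↔
      tupleInput G ![i, j] = tupleInput H ![i', j'] ∧ (i = j ↔ i' = j') ∧
      G.edgeFeat i i = H.edgeFeat i' i' ∧ G.edgeFeat j j = H.edgeFeat j' j' := by
  rw [tupleInput_pair_eq_iff, atomicType_eq_iff]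
  constructor
  · rintro ⟨h₁, h₂, h₃, h₄, h₅⟩
    exact ⟨⟨h₁, h₂ 0, h₂ 1, h₄ 0 1, h₅ 0 1⟩, h₃ 0 1, h₅ 0 0, h₅ 1 1⟩
  · rintro ⟨⟨h₁, h₂, h₃, h₄, h₅⟩, h₆, h₇, h₈⟩
    refine ⟨h₁, ?_, ?_, ?_, ?_⟩
    · intro a; fin_cases a <;> assumption
    · intro a b
      fin_cases a <;> fin_cases b <;> simp [h₆, eq_comm (a := j), eq_comm (a := j')]
    · intro a b
      fin_cases a <;> fin_cases b <;> simp [h₄, G.graph.adj_comm j, H.graph.adj_comm j']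
    · intro a b
      fin_cases a <;> fin_cases b <;>
        simp [h₅, h₇, h₈, G.edgeFeat_symm j i, H.edgeFeat_symm j' i']

theorem tupleInput_swap {i j : V} {i' j' : W}
    (h : tupleInput G ![i, j] = tupleInput H ![i', j']) :
    tupleInput G ![j, i] = tupleInput H ![j', i'] := by
  rw [tupleInput_pair_eq_iff] at h ⊢
  rw [G.graph.adj_comm, H.graph.adj_comm, G.edgeFeat_symm j, H.edgeFeat_symm j']
  tauto

theorem atomicType_swap {i j : V} {i' j' : W}
    (h : atomicType G ![i, j] = atomicType H ![i', j']) :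
    atomicType G ![j, i] = atomicType H ![j', i'] := by
  rw [atomicType_pair_eq_iff] at h ⊢
  exact ⟨tupleInput_swap h.1, by rw [eq_comm, h.2.1, eq_comm], h.2.2.2, h.2.2.1⟩

end Initial

/-! ### Refinement without equality information -/

section Twins

variable {V : Type u} {W : Type v} {dn de dg : ℕ}

/-- Vertices that look the same from every vertex, as far as the inputs of a network go. -/
def Twin (G : FeaturedGraph V dn de dg) (i j : V) : Prop :=
  ∀ p, tupleInput G ![i, p] = tupleInput G ![j, p]

variable {G : FeaturedGraph V dn de dg} {H : FeaturedGraph W dn de dg}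

theorem Twin.symm {i j : V} (h : Twin G i j) : Twin G j i := fun p => (h p).symm

theorem Twin.swap [DecidableEq V] {i j : V} (h : Twin G i j) (q : V) :
    Twin G q (Equiv.swap i j q) := by
  by_cases h₁ : q = i
  · subst h₁; simpa using h
  by_cases h₂ : q = j
  · subst h₂; simpa using h.symm
  rw [Equiv.swap_apply_of_ne_of_ne h₁ h₂]
  exact fun _ => rfl

variable [Fintype V] [Fintype W]

/-- Pairs that a network cannot tell apart. -/
abbrev InputIndist (G : FeaturedGraph V dn de dg) (H : FeaturedGraph W dn de dg) (i j : V)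
    (i' j' : W) : Prop :=
  Indist (tupleInput G) (tupleInput H) ![i, j] ![i', j']

theorem InputIndist.swap {i j : V} {i' j' : W} (h : InputIndist G H i j i' j') :
    InputIndist G H j i j' i' :=
  Indist.swap (fun _ _ _ _ => tupleInput_swap) h

/-- The identity is a valid reply, since replacing either entry leaves a pair of twins in the other
position. -/
theorem Twin.inputIndist {i i' j j' : V} (hi : Twin G i i') (hj : Twin G j j') :
    InputIndist G G i j i' j' := by
  refine indist_of_pair_bisimulation (fun i j i' j' => Twin G i i' ∧ Twin G j j') ?_ ?_ ⟨hi, hj⟩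
  · rintro i j i' j' ⟨hi, hj⟩
    exact (hi j).trans (tupleInput_swap (hj i'))
  · rintro i j i' j' ⟨hi, hj⟩
    exact ⟨Equiv.refl V, fun p => ⟨⟨hi, fun _ => rfl⟩, fun _ => rfl, hj⟩⟩

/-- Each vertex of `H` is the image of a pivot `p`, and the rows of `i'` and `j'` there copy the
rows of `i` and `j` at `p`. -/
theorem InputIndist.twin {i j : V} {i' j' : W} (h : InputIndist G H i j i' j')
    (ht : Twin G i j) : Twin H i' j' := by
  obtain ⟨σ, hσ⟩ := h.exists_equiv_pair
  intro q
  obtain ⟨p, rfl⟩ := σ.surjective q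
  exact (hσ p).1.init.symm.trans ((ht p).trans (InputIndist.swap (hσ p).2).init)

theorem InputIndist.twin_right {i j : V} {i' j' j'' : W} (h : InputIndist G H i j i' j')
    (ht : Twin H j' j'') : InputIndist G H i j i' j'' :=
  Indist.trans h (Twin.inputIndist (fun _ => rfl) ht)

/-- The pivot `i` shows that `(i, i)` and `(i', σ i)` look alike, so `σ i` and `i'` are twins.
Following `σ` by their transposition sends `i` to `i'` and changes no colour. -/
theorem InputIndist.exists_equiv_apply_left {i j : V} {i' j' : W}
    (h : InputIndist G H i j i' j') :
    ∃ σ : V ≃ W, σ i = i' ∧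
      ∀ p, InputIndist G H i p i' (σ p) ∧ InputIndist G H p j (σ p) j' := by
  classical
  obtain ⟨σ, hσ⟩ := h.exists_equiv_pair
  have hswap := Twin.swap (InputIndist.twin (hσ i).1 fun _ => rfl).symm
  refine ⟨σ.trans (Equiv.swap (σ i) i'), by simp, fun p => ⟨?_, ?_⟩⟩
  · exact InputIndist.twin_right (hσ p).1 (hswap _)
  · exact (InputIndist.twin_right (InputIndist.swap (hσ p).2) (hswap _)).swap

/-- If `i ≠ j`, a second transposition, of the twins `σ j` and `j'`, corrects the image of `j`. It
fixes `i'`, which differs from `σ j` by injectivity and from `j'` by `hij`. -/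
theorem InputIndist.exists_equiv_apply {i j : V} {i' j' : W}
    (h : InputIndist G H i j i' j') (hij : i = j ↔ i' = j') :
    ∃ σ : V ≃ W, σ i = i' ∧ σ j = j' ∧
      ∀ p, InputIndist G H i p i' (σ p) ∧ InputIndist G H p j (σ p) j' := by
  classical
  obtain ⟨σ, hi, hσ⟩ := h.exists_equiv_apply_left
  by_cases h₀ : i = j
  · exact ⟨σ, hi, by rw [← h₀, hi, hij.1 h₀], hσ⟩
  have hswap := Twin.swap (InputIndist.twin (hσ j).2 fun _ => rfl)
  refine ⟨σ.trans (Equiv.swap (σ j) j'), ?_, by simp, fun p => ⟨?_, ?_⟩⟩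
  · rw [Equiv.trans_apply, hi, Equiv.swap_apply_of_ne_of_ne]
    · rw [← hi]; exact fun h => h₀ (σ.injective h)
    · exact fun h => h₀ (hij.2 h)
  · exact InputIndist.twin_right (hσ p).1 (hswap _)
  · exact (InputIndist.twin_right (InputIndist.swap (hσ p).2) (hswap _)).swap

theorem InputIndist.diag {i j : V} {i' j' : W} (h : InputIndist G H i j i' j') :
    InputIndist G H i i i' i' := by
  obtain ⟨σ, hi, hσ⟩ := h.exists_equiv_apply_left
  simpa [hi] using (hσ i).1

/-- Replies with `i ↦ i'` and `j ↦ j'` preserve equality of a pivot with `i` or `j` by injectivity,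
so equality patterns can be carried along the bisimulation. -/
theorem InputIndist.atomicIndist {i j : V} {i' j' : W}
    (h : InputIndist G H i j i' j') (hij : i = j ↔ i' = j') :
    Indist (atomicType G) (atomicType H) ![i, j] ![i', j'] := by
  refine indist_of_pair_bisimulation
    (fun i j i' j' => InputIndist G H i j i' j' ∧ (i = j ↔ i' = j')) ?_ ?_ ⟨h, hij⟩
  · rintro i j i' j' ⟨h, hij⟩
    have h₁ := (tupleInput_pair_eq_iff.1 h.diag.init).2.2.2.2
    have h₂ := (tupleInput_pair_eq_iff.1 h.swap.diag.init).2.2.2.2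
    exact atomicType_pair_eq_iff.2 ⟨h.init, hij, h₁, h₂⟩
  · rintro i j i' j' ⟨h, hij⟩
    obtain ⟨σ, hi, hj, hσ⟩ := h.exists_equiv_apply hij
    refine ⟨σ, fun p => ⟨⟨(hσ p).1, ?_⟩, (hσ p).2, ?_⟩⟩
    · rw [← hi, σ.apply_eq_iff_eq]
    · rw [← hj, σ.apply_eq_iff_eq]

/-- The multisets of colours agree after every number of rounds of refinement of the colouring of
pairs by the inputs of a network. -/
def InputEquivalent (G : FeaturedGraph V dn de dg) (H : FeaturedGraph W dn de dg) : Prop :=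
  ∀ t, (Finset.univ : Finset (Fin 2 → V)).val.map (refine (tupleInput G) t) =
    (Finset.univ : Finset (Fin 2 → W)).val.map (refine (tupleInput H) t)

theorem card_eq_of_equiv_tuples {k : ℕ} (hk : k ≠ 0) (τ : (Fin k → V) ≃ (Fin k → W)) :
    Fintype.card V = Fintype.card W := by
  have := Fintype.card_congr τ
  simp only [Fintype.card_fun, Fintype.card_fin] at this
  exact Nat.pow_left_injective hk this

/-- The bijection of pairs need not preserve the diagonal, but the colour of `(i, j)` determines
that of `(i, i)`; the second coordinate is then cancelled by counting. -/
theorem InputEquivalent.exists_equiv_diag (h : InputEquivalent G H) :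
    ∃ ρ : V ≃ W, ∀ i, InputIndist G H i i (ρ i) (ρ i) := by
  obtain ⟨τ, hτ⟩ := exists_equiv_indist h
  have hcard := card_eq_of_equiv_tuples two_ne_zero τ
  rcases isEmpty_or_nonempty V with hV | hV
  · exact ⟨Fintype.equivOfCardEq hcard, fun i => isEmptyElim i⟩
  obtain ⟨ρ, hρ⟩ := exists_equiv_fst hcard
    (f := fun i t => refine (tupleInput G) t ![i, i])
    (g := fun i t => refine (tupleInput H) t ![i, i])
    (((finTwoArrowEquiv V).symm.trans τ).trans (finTwoArrowEquiv W)) (by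
      rintro ⟨i, j⟩
      funext t
      have := hτ ![i, j]
      rw [eq_pair (τ ![i, j])] at this
      exact InputIndist.diag this t)
  exact ⟨ρ, fun i t => congrFun (hρ i) t⟩

theorem InputEquivalent.not_fwlDistinguishes (h : InputEquivalent G H) :
    ¬ FWLDistinguishes 2 G H := by
  rintro ⟨t, ht⟩
  apply ht
  rw [fwlColor_eq_refine, fwlColor_eq_refine]
  obtain ⟨ρ, hρ⟩ := h.exists_equiv_diag
  choose σ hi hσ using fun i => (hρ i).exists_equiv_apply_left
  -- The shear `(i, p) ↦ (ρ i, σ i p)` sends exactly the diagonal to the diagonal, because `σ i i =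
  -- ρ i`.
  refine map_univ_eq_of_equiv
    (((finTwoArrowEquiv V).trans (Equiv.prodShear ρ σ)).trans (finTwoArrowEquiv W).symm) ?_
  intro e
  rw [eq_pair e]
  refine InputIndist.atomicIndist (hσ (e 0) (e 1)).1 ?_ t
  rw [← hi (e 0), (σ (e 0)).apply_eq_iff_eq]

/-- The pebble reply at `(i, i)` maps the neighbours of `i` onto those of `i'`, preserving edge
features and diagonal colours. -/
theorem InputIndist.oneWLColor_eq {i : V} {i' : W} (h : InputIndist G H i i i' i') (t : ℕ) :
    oneWLColor G t i = oneWLColor H t i' := by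
  classical
  induction t generalizing i i' with
  | zero =>
    have := tupleInput_pair_eq_iff.1 h.init
    exact Prod.ext this.1 this.2.1
  | succ t ih =>
    obtain ⟨σ, hσ⟩ := h.exists_equiv_pair
    have hp := fun p => tupleInput_pair_eq_iff.1 (hσ p).1.init
    refine Prod.ext (ih h) ?_
    have hn : ∀ (_ : Fintype (H.graph.neighborSet i')) (_ : Fintype (G.graph.neighborSet i)),
        (H.graph.neighborFinset i').val = (G.graph.neighborFinset i).val.map σ := by
      intro _ _
      refine (congrArg Finset.val ?_).trans (Finset.map_val σ.toEmbedding _)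
      ext q
      obtain ⟨p, rfl⟩ := σ.surjective q
      simp [← (hp p).2.2.2.1]
    simp only [oneWLColor]
    rw [hn, Multiset.map_map]
    refine Multiset.map_congr rfl fun p _ => ?_
    exact Prod.ext (hp p).2.2.2.2 (ih (InputIndist.swap (hσ p).1).diag)

theorem InputEquivalent.not_oneWLDistinguishes (h : InputEquivalent G H) :
    ¬ OneWLDistinguishes G H := by
  rintro ⟨t, ht⟩
  obtain ⟨ρ, hρ⟩ := h.exists_equiv_diag
  exact ht (map_univ_eq_of_equiv ρ fun i => (hρ i).oneWLColor_eq t)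

end Twins

/-! ### Equivalence of `2`-FWL and `3`-WL -/

section WL

variable {V : Type u} {W : Type v} [Fintype V] [Fintype W] {dn de dg k : ℕ}
  {G : FeaturedGraph V dn de dg} {H : FeaturedGraph W dn de dg}

theorem wlColor_succ (G : FeaturedGraph V dn de dg) (t : ℕ) (e : Fin k → V) :
    wlColor G k (t + 1) e = (wlColor G k t e, fun i =>
      (Finset.univ : Finset V).val.map fun p => wlColor G k t (Function.update e i p)) :=
  rfl

/-- Tuples with the same `k`-WL colour after every number of rounds. -/
def WLIndist (G : FeaturedGraph V dn de dg) (H : FeaturedGraph W dn de dg) (e : Fin k → V)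
    (e' : Fin k → W) : Prop :=
  ∀ t, wlColor G k t e = wlColor H k t e'

theorem wlColor_eq_of_succ {t : ℕ} {e : Fin k → V} {e' : Fin k → W}
    (h : wlColor G k (t + 1) e = wlColor H k (t + 1) e') : wlColor G k t e = wlColor H k t e' :=
  congrArg Prod.fst h

theorem WLIndist.exists_equiv {e : Fin k → V} {e' : Fin k → W} (h : WLIndist G H e e')
    (i : Fin k) :
    ∃ σ : V ≃ W, ∀ p, WLIndist G H (Function.update e i p) (Function.update e' i (σ p)) := by
  classical
  obtain ⟨σ, hσ⟩ := exists_forall_of_succ_imp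
    (P := fun t (σ : V ≃ W) => ∀ p,
      wlColor G k t (Function.update e i p) = wlColor H k t (Function.update e' i (σ p)))
    (fun t σ hs p => wlColor_eq_of_succ (hs p))
    (fun t => by
      have := h (t + 1)
      rw [wlColor_succ, wlColor_succ] at this
      exact exists_equiv_of_map_univ_eq (congrFun (congrArg Prod.snd this) i))
  exact ⟨σ, fun p t => hσ t p⟩

theorem exists_equiv_wlIndist (h : ¬ WLDistinguishes k G H) :
    ∃ τ : (Fin k → V) ≃ (Fin k → W), ∀ e, WLIndist G H e (τ e) := by
  classical
  simp only [WLDistinguishes, not_exists, not_not] at h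
  obtain ⟨τ, hτ⟩ := exists_forall_of_succ_imp
    (P := fun t (τ : (Fin k → V) ≃ (Fin k → W)) => ∀ e, wlColor G k t e = wlColor H k t (τ e))
    (fun t τ hs e => wlColor_eq_of_succ (hs e))
    (fun t => exists_equiv_of_map_univ_eq (by convert h t))
  exact ⟨τ, fun e t => hτ t e⟩

theorem wlIndist_of_bisimulation (Z : (Fin k → V) → (Fin k → W) → Prop)
    (h₀ : ∀ e e', Z e e' → atomicType G e = atomicType H e')
    (hs : ∀ e e', Z e e' → ∀ i, ∃ σ : V ≃ W, ∀ p,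
      Z (Function.update e i p) (Function.update e' i (σ p)))
    {e : Fin k → V} {e' : Fin k → W} (h : Z e e') : WLIndist G H e e' := by
  intro t
  induction t generalizing e e' with
  | zero => exact h₀ _ _ h
  | succ t ih =>
    rw [wlColor_succ, wlColor_succ]
    refine Prod.ext (ih h) (funext fun i => ?_)
    obtain ⟨σ, hσ⟩ := hs _ _ h i
    exact map_univ_eq_of_equiv σ fun p => ih (hσ p)

/-- Pairs with the same `2`-FWL colour after every number of rounds. -/
abbrev FWLIndist (G : FeaturedGraph V dn de dg) (H : FeaturedGraph W dn de dg) (i j : V)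
    (i' j' : W) : Prop :=
  Indist (atomicType G) (atomicType H) ![i, j] ![i', j']

theorem FWLIndist.swap {i j : V} {i' j' : W} (h : FWLIndist G H i j i' j') :
    FWLIndist G H j i j' i' :=
  Indist.swap (fun _ _ _ _ => atomicType_swap) h

theorem exists_equiv_fwlIndist (h : ¬ FWLDistinguishes 2 G H) :
    ∃ τ : (Fin 2 → V) ≃ (Fin 2 → W), ∀ e, Indist (atomicType G) (atomicType H) e (τ e) := by
  simp only [FWLDistinguishes, not_exists, not_not, fwlColor_eq_refine] at h
  exact exists_equiv_indist fun t => by convert h t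

theorem indist_iff_pair {A : Type} {c : (Fin 2 → V) → A} {d : (Fin 2 → W) → A} {e : Fin 2 → V}
    {e' : Fin 2 → W} : Indist c d e e' ↔ Indist c d ![e 0, e 1] ![e' 0, e' 1] := by
  rw [← eq_pair, ← eq_pair]

theorem exists_ne_of_fin_three (x : Fin 3) :
    ∃ y z : Fin 3, y ≠ x ∧ z ≠ x ∧ y ≠ z ∧ ∀ a, a = x ∨ a = y ∨ a = z := by
  revert x; decide

/-- Triples all of whose pairs of distinct positions have the same `2`-FWL colours. -/
def PairwiseIndist (G : FeaturedGraph V dn de dg) (H : FeaturedGraph W dn de dg)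
    (e : Fin 3 → V) (e' : Fin 3 → W) : Prop :=
  ∀ a b, a ≠ b → FWLIndist G H (e a) (e b) (e' a) (e' b)

theorem PairwiseIndist.of_three {e : Fin 3 → V} {e' : Fin 3 → W} {x y z : Fin 3}
    (hx : ∀ a, a = x ∨ a = y ∨ a = z)
    (h₁ : FWLIndist G H (e x) (e y) (e' x) (e' y)) (h₂ : FWLIndist G H (e x) (e z) (e' x) (e' z))
    (h₃ : FWLIndist G H (e y) (e z) (e' y) (e' z)) : PairwiseIndist G H e e' := by
  intro a b hab
  rcases hx a with rfl | rfl | rfl <;> rcases hx b with rfl | rfl | rfl <;>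
    first
    | exact absurd rfl hab
    | assumption
    | exact FWLIndist.swap (by assumption)

/-- When position `x` is replaced, the other two positions form a pair whose 2-FWL bijection
controls both new pairs at once. -/
theorem PairwiseIndist.wlIndist {e : Fin 3 → V} {e' : Fin 3 → W}
    (h : PairwiseIndist G H e e') : WLIndist G H e e' := by
  refine wlIndist_of_bisimulation (PairwiseIndist G H) ?_ ?_ h
  · intro e e' h
    have hp : ∀ a b, a ≠ b → _ := fun a b hab => atomicType_pair_eq_iff.1 (h a b hab).init
    have ht : ∀ a b, a ≠ b → _ := fun a b hab => tupleInput_pair_eq_iff.1 (hp a b hab).1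
    refine atomicType_eq_iff.2 ⟨(ht 0 1 (by decide)).1, fun a => ?_, fun a b => ?_, fun a b => ?_,
      fun a b => ?_⟩
    · obtain ⟨b, _, hb, -⟩ := exists_ne_of_fin_three a
      exact (ht a b hb.symm).2.1
    · rcases eq_or_ne a b with rfl | hab
      · simp
      · exact (hp a b hab).2.1
    · rcases eq_or_ne a b with rfl | hab
      · simp
      · exact (ht a b hab).2.2.2.1
    · rcases eq_or_ne a b with rfl | hab
      · obtain ⟨b, _, hb, -⟩ := exists_ne_of_fin_three a
        exact (hp a b hb.symm).2.2.1
      · exact (ht a b hab).2.2.2.2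
  · intro e e' h x
    obtain ⟨y, z, hyx, hzx, hyz, hx⟩ := exists_ne_of_fin_three x
    obtain ⟨σ, hσ⟩ := (h y z hyz).exists_equiv_pair
    refine ⟨σ, fun p => PairwiseIndist.of_three hx ?_ ?_ ?_⟩
    · simpa [hyx] using FWLIndist.swap (hσ p).1
    · simpa [hzx] using (hσ p).2
    · simpa [hyx, hzx] using h y z hyz

/-- A triple is a pair with a pivot in front, so the bijection of pairs and the pivot bijections
over it assemble to a shear of triples. -/
theorem not_wlDistinguishes_of_not_fwlDistinguishes (h : ¬ FWLDistinguishes 2 G H) :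
    ¬ WLDistinguishes 3 G H := by
  obtain ⟨τ, hτ⟩ := exists_equiv_fwlIndist h
  choose σ hσ using fun e => Indist.exists_equiv_pair
    (c := atomicType G) (d := atomicType H) (i := e 0) (j := e 1) (i' := τ e 0) (j' := τ e 1)
    (by simpa only [← eq_pair] using hτ e)
  rintro ⟨t, ht⟩
  apply ht
  let eV := (Fin.consEquiv fun _ : Fin 3 => V).symm.trans (Equiv.prodComm _ _)
  let eW := (Fin.consEquiv fun _ : Fin 3 => W).symm.trans (Equiv.prodComm _ _)
  have := map_univ_eq_of_equiv (f := wlColor G 3 t) (g := wlColor H 3 t)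
    ((eV.trans (Equiv.prodShear τ σ)).trans eW.symm) (fun e => ?_)
  · convert this
  refine PairwiseIndist.wlIndist (PairwiseIndist.of_three (x := 0) (y := 1) (z := 2) (by decide)
    ?_ ?_ ?_) t
  · exact FWLIndist.swap (hσ (Fin.tail e) (e 0)).1
  · exact (hσ (Fin.tail e) (e 0)).2
  · exact indist_iff_pair.1 (hτ (Fin.tail e))

/-- The third position `z` holds the pivot: after `z` is replaced by `p`, the pairs at `(x, z)` and
`(z, y)` are the two segments. The relation therefore allows any two distinct positions. -/
theorem WLIndist.fwlIndist {e : Fin 3 → V} {e' : Fin 3 → W} (h : WLIndist G H e e')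
    {x y : Fin 3} (hxy : x ≠ y) : FWLIndist G H (e x) (e y) (e' x) (e' y) := by
  refine indist_of_pair_bisimulation (fun i j i' j' => ∃ (e : Fin 3 → V) (e' : Fin 3 → W)
    (x y : Fin 3), WLIndist G H e e' ∧ x ≠ y ∧ e x = i ∧ e y = j ∧ e' x = i' ∧ e' y = j')
    ?_ ?_ ⟨e, e', x, y, h, hxy, rfl, rfl, rfl, rfl⟩
  · rintro _ _ _ _ ⟨e, e', x, y, h, hxy, rfl, rfl, rfl, rfl⟩
    obtain ⟨h₁, h₂, h₃, h₄, h₅⟩ := atomicType_eq_iff.1 (h 0)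
    exact atomicType_pair_eq_iff.2 ⟨tupleInput_pair_eq_iff.2 ⟨h₁, h₂ x, h₂ y, h₄ x y, h₅ x y⟩,
      h₃ x y, h₅ x x, h₅ y y⟩
  · rintro _ _ _ _ ⟨e, e', x, y, h, hxy, rfl, rfl, rfl, rfl⟩
    obtain ⟨z, hzx, hzy⟩ : ∃ z : Fin 3, z ≠ x ∧ z ≠ y := by
      clear h; revert x y; decide
    obtain ⟨σ, hσ⟩ := h.exists_equiv z
    exact ⟨σ, fun p => ⟨⟨_, _, x, z, hσ p, hzx.symm, by simp [hzx.symm], by simp,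
      by simp [hzx.symm], by simp⟩, ⟨_, _, z, y, hσ p, hzy, by simp, by simp [hzy.symm],
      by simp, by simp [hzy.symm]⟩⟩⟩

theorem not_fwlDistinguishes_of_not_wlDistinguishes (h : ¬ WLDistinguishes 3 G H) :
    ¬ FWLDistinguishes 2 G H := by
  obtain ⟨τ, hτ⟩ := exists_equiv_wlIndist h
  have hcard := card_eq_of_equiv_tuples three_ne_zero τ
  rintro ⟨t, ht⟩
  apply ht
  rw [fwlColor_eq_refine, fwlColor_eq_refine]
  suffices ∃ ρ : (Fin 2 → V) ≃ (Fin 2 → W),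
      ∀ e, refine (atomicType G) t e = refine (atomicType H) t (ρ e) by
    obtain ⟨ρ, hρ⟩ := this
    convert map_univ_eq_of_equiv ρ hρ
  rcases isEmpty_or_nonempty V with hV | hV
  · exact ⟨Fintype.equivOfCardEq (by rw [Fintype.card_fun, Fintype.card_fun, hcard]),
      fun e => isEmptyElim (e 0)⟩
  let eV := (Fin.consEquiv fun _ : Fin 3 => V).symm.trans (Equiv.prodComm _ _)
  let eW := (Fin.consEquiv fun _ : Fin 3 => W).symm.trans (Equiv.prodComm _ _)
  -- Forgetting the first entry of a triple counts every pair `|V|` times, and this factor cancels.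
  refine exists_equiv_fst hcard ((eV.symm.trans τ).trans eW) fun e => ?_
  have := (hτ (eV.symm e)).fwlIndist (x := 1) (y := 2) (by decide) t
  rw [eq_pair e.1, eq_pair (((eV.symm.trans τ).trans eW) e).1]
  exact this

theorem fwlDistinguishes_iff_wlDistinguishes :
    FWLDistinguishes 2 G H ↔ WLDistinguishes 3 G H :=
  not_iff_not.1
    ⟨not_wlDistinguishes_of_not_fwlDistinguishes, not_fwlDistinguishes_of_not_wlDistinguishes⟩

end WL

/-! ### Message passing networks are bounded by `1`-WL -/

/-- The state of a node after `l` layers, as a function of its `1`-WL colour. -/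
def MPNN.stateOfColor {dn de dg : ℕ} (M : MPNN dn de dg) :
    (l : ℕ) → OneWLColor dn de dg l → Vec M.width
  | 0, x => M.start x.1 x.2
  | l + 1, x => M.update l (M.stateOfColor l x.1) (M.aggregate l
      (Multiset.map (fun y => M.message l (M.stateOfColor l x.1) (M.stateOfColor l y.2) y.1) x.2))

theorem MPNN.state_eq {V : Type u} [Fintype V] {dn de dg : ℕ} (M : MPNN dn de dg)
    (G : FeaturedGraph V dn de dg) (l : ℕ) (i : V) :
    M.state G l i = M.stateOfColor l (oneWLColor G l i) := by
  induction l generalizing i with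
  | zero => rfl
  | succ l ih => simp only [MPNN.state, MPNN.stateOfColor, oneWLColor, Multiset.map_map, ih,
      Function.comp_def]

theorem MPNNDistinguishes.oneWLDistinguishes {V : Type u} {W : Type v} [Fintype V] [Fintype W]
    {dn de dg : ℕ} {G : FeaturedGraph V dn de dg} {H : FeaturedGraph W dn de dg}
    (h : MPNNDistinguishes G H) : OneWLDistinguishes G H := by
  obtain ⟨M, hM⟩ := h
  refine ⟨M.depth, fun h => hM ?_⟩
  have := congrArg (Multiset.map (M.stateOfColor M.depth)) h
  simpa only [Multiset.map_map, Function.comp_def, ← M.state_eq] using this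

/-! ### FloydNet as `2`-FloydNet -/

theorem tupleInput_pair {V : Type u} {dn de dg : ℕ} (G : FeaturedGraph V dn de dg) (i j : V) :
    tupleInput G ![i, j] =
      concatInput G.graphFeat (G.nodeFeat i) (G.nodeFeat j) (G.pairInput i j) := by
  funext x
  match x with
  | .inl _ => rfl
  | .inr (.inl (a, _)) => fin_cases a <;> rfl
  | .inr (.inr (⟨(a, b), hab⟩, _)) =>
    fin_cases a <;> fin_cases b <;> first | rfl | exact absurd hab (by decide)

section PairTuple

variable {V : Type u} [Fintype V]

/-- Replacing position `1` of a pair gives the first segment of the path and position `0` the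
second; the order is immaterial as both combine operations commute. -/
theorem Block.tupleApply_eq_pairApply {h dh : ℕ} (cfg : Config) (B : Block 2 h dh)
    (R : (Fin 2 → V) → Vec (h * dh)) (i j : V) :
    B.tupleApply cfg R ![i, j] = B.pairApply cfg (fun i j => R ![i, j]) i j := by
  simp only [Block.tupleApply, Block.pairApply, Block.tupleAttention, Block.pairAttention,
    Config.combineAll, Config.combineTwo, Fin.sum_univ_two, Fin.prod_univ_two, update_pair_zero,
    update_pair_one]
  rcases cfg with ⟨nk, ck, ε, hε⟩
  cases ck <;> simp only [add_comm, mul_comm]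

theorem Net.pairRep_eq_tupleRep {dn de dg : ℕ} (cfg : Config) (N : Net 2 dn de dg)
    (G : FeaturedGraph V dn de dg) (i j : V) :
    N.pairRep cfg G i j = N.tupleRep cfg G ![i, j] := by
  have key : ∀ (L : List (Block 2 N.heads N.headDim)) (R : (Fin 2 → V) → _) (i j : V),
      L.foldl (fun R B => B.pairApply cfg R) (fun i j => R ![i, j]) i j =
        L.foldl (fun R B => B.tupleApply cfg R) R ![i, j] := by
    intro L
    induction L with
    | nil => intro R i j; rfl
    | cons B L ih =>
      intro R i j
      simp only [List.foldl_cons]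
      rw [← ih]
      simp only [Block.tupleApply_eq_pairApply]
  simp only [Net.pairRep, Net.tupleRep, ← tupleInput_pair]
  exact key N.blocks (fun e => N.start.eval (tupleInput G e)) i j

end PairTuple

/-! ### FloydNet is bounded by `2`-FWL -/

section UpperBound

variable {V : Type u} {W : Type v} [Fintype V] [Fintype W] {dn de dg k : ℕ}

theorem attend_eq_of_equiv {d : ℕ} {q q' : Vec d} {key val : V → Vec d} {key' val' : W → Vec d}
    (σ : V ≃ W) (hq : q = q') (hk : ∀ p, key p = key' (σ p)) (hv : ∀ p, val p = val' (σ p)) :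
    attend q key val = attend q' key' val' := by
  subst hq
  simp only [attend, hk, hv]
  rw [σ.sum_comp fun p => Real.exp ((q ⬝ᵥ key' p) / Real.sqrt d)]
  exact σ.sum_comp fun p => (Real.exp ((q ⬝ᵥ key' p) / Real.sqrt d) /
    ∑ p', Real.exp ((q ⬝ᵥ key' p') / Real.sqrt d)) • val' p

theorem Block.tupleApply_eq_of_equiv {h dh : ℕ} (cfg : Config) (B : Block k h dh)
    {R : (Fin k → V) → Vec (h * dh)} {R' : (Fin k → W) → Vec (h * dh)} {e : Fin k → V}
    {e' : Fin k → W} (he : R e = R' e') (σ : V ≃ W)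
    (hσ : ∀ p i, R (Function.update e i p) = R' (Function.update e' i (σ p))) :
    B.tupleApply cfg R e = B.tupleApply cfg R' e' := by
  have : B.tupleAttention cfg (fun e => cfg.blockNorm B.normAttention (R e)) e =
      B.tupleAttention cfg (fun e => cfg.blockNorm B.normAttention (R' e)) e' := by
    unfold Block.tupleAttention
    congr 1
    funext hc
    refine congrFun (attend_eq_of_equiv σ (by simp only [he]) (fun p => ?_) (fun p => ?_)) hc.2
    · congr 1; funext i; exact congrArg _ (congrArg _ (congrArg _ (hσ p i)))
    · congr 1; funext i; exact congrArg _ (congrArg _ (hσ p i))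
  simp only [Block.tupleApply, this, he]

/-- `Indist` is already stable under refinement, so the same relation serves as invariant for every
block. -/
theorem foldl_tupleApply_eq_of_indist {A : Type} {h dh : ℕ} (cfg : Config)
    (L : List (Block k h dh)) {c : (Fin k → V) → A} {d : (Fin k → W) → A}
    {R : (Fin k → V) → Vec (h * dh)} {R' : (Fin k → W) → Vec (h * dh)}
    (hR : ∀ e e', Indist c d e e' → R e = R' e') {e : Fin k → V} {e' : Fin k → W}
    (he : Indist c d e e') :
    L.foldl (fun R B => B.tupleApply cfg R) R e = L.foldl (fun R B => B.tupleApply cfg R) R' e' := by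
  induction L generalizing R R' with
  | nil => exact hR _ _ he
  | cons B L ih =>
    refine ih fun e e' he => ?_
    obtain ⟨σ, hσ⟩ := he.exists_equiv
    exact B.tupleApply_eq_of_equiv cfg (hR _ _ he) σ fun p i => hR _ _ (hσ p i)

theorem FloydNetDistinguishes.fwlDistinguishes {cfg : Config} {G : FeaturedGraph V dn de dg}
    {H : FeaturedGraph W dn de dg} (h : FloydNetDistinguishes cfg G H) :
    FWLDistinguishes 2 G H := by
  obtain ⟨N, hN⟩ := h
  by_contra hc
  obtain ⟨τ, hτ⟩ := exists_equiv_fwlIndist hc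
  refine hN (map_univ_eq_of_equiv
    (((finTwoArrowEquiv V).symm.trans τ).trans (finTwoArrowEquiv W)) fun e => ?_)
  rw [N.pairRep_eq_tupleRep, N.pairRep_eq_tupleRep]
  refine foldl_tupleApply_eq_of_indist cfg N.blocks (c := atomicType G) (d := atomicType H)
    (fun e e' h => ?_) ?_
  · obtain ⟨h₁, h₂, -, h₄, h₅⟩ := atomicType_eq_iff.1 h.init
    exact congrArg _ (tupleInput_eq_iff.2 ⟨h₁, h₂, fun a b _ => ⟨h₄ a b, h₅ a b⟩⟩)
  · have := hτ ![e.1, e.2]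
    rwa [eq_pair (τ _)] at this

end UpperBound

/-! ### The six-cycle and two triangles -/

section Strict

/-- The cycle of length six. -/
def hexagon : SimpleGraph (Fin 6) where
  Adj i j := j = i + 1 ∨ i = j + 1
  symm := ⟨fun _ _ h => h.symm⟩
  loopless := ⟨by decide⟩

/-- Two disjoint triangles. -/
def twoTriangles : SimpleGraph (Fin 6) where
  Adj i j := i ≠ j ∧ (i.val < 3 ↔ j.val < 3)
  symm := ⟨fun _ _ h => ⟨h.1.symm, h.2.symm⟩⟩
  loopless := ⟨fun _ h => h.1 rfl⟩

instance : DecidableRel hexagon.Adj := fun i j =>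
  inferInstanceAs (Decidable (j = i + 1 ∨ i = j + 1))

instance : DecidableRel twoTriangles.Adj := fun i j =>
  inferInstanceAs (Decidable (i ≠ j ∧ (i.val < 3 ↔ j.val < 3)))

variable {dn de dg : ℕ}

/-- By induction on the rounds, all vertices of both graphs share one colour. -/
theorem not_oneWLDistinguishes_of_regular {V : Type u} {W : Type v} [Fintype V] [Fintype W]
    {S : SimpleGraph V} {T : SimpleGraph W} [DecidableRel S.Adj] [DecidableRel T.Adj] {r : ℕ}
    (hS : S.IsRegularOfDegree r) (hT : T.IsRegularOfDegree r)
    (hVW : Fintype.card V = Fintype.card W) :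
    ¬ OneWLDistinguishes (FeaturedGraph.plain S dn de dg) (FeaturedGraph.plain T dn de dg) := by
  classical
  have key : ∀ t, ∃ x, (∀ i, oneWLColor (FeaturedGraph.plain S dn de dg) t i = x) ∧
      ∀ i, oneWLColor (FeaturedGraph.plain T dn de dg) t i = x := by
    intro t
    induction t with
    | zero => exact ⟨(0, 0), fun _ => rfl, fun _ => rfl⟩
    | succ t ih =>
      obtain ⟨x, h₁, h₂⟩ := ih
      refine ⟨(x, Multiset.replicate r (0, x)), fun i => ?_, fun i => ?_⟩
      · simp only [oneWLColor, h₁]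
        refine Prod.ext rfl (Eq.trans (b := Multiset.map (fun _ => ((0 : Vec de), x)) _) rfl ?_)
        rw [Multiset.map_const']
        congr 1
        rw [← hS i, ← SimpleGraph.card_neighborFinset_eq_degree, Finset.card]
        congr!
      · simp only [oneWLColor, h₂]
        refine Prod.ext rfl (Eq.trans (b := Multiset.map (fun _ => ((0 : Vec de), x)) _) rfl ?_)
        rw [Multiset.map_const']
        congr 1
        rw [← hT i, ← SimpleGraph.card_neighborFinset_eq_degree, Finset.card]
        congr!
  rintro ⟨t, ht⟩
  obtain ⟨x, h₁, h₂⟩ := key t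
  exact ht (map_univ_eq_of_equiv (Fintype.equivOfCardEq hVW) fun i => by rw [h₁, h₂])

theorem fwlDistinguishes_twoTriangles_hexagon :
    FWLDistinguishes 2 (FeaturedGraph.plain twoTriangles dn de dg)
      (FeaturedGraph.plain hexagon dn de dg) := by
  by_contra hc
  obtain ⟨τ, hτ⟩ := exists_equiv_fwlIndist hc
  have h := hτ ![0, 1]
  rw [eq_pair (τ _)] at h
  obtain ⟨σ, hσ⟩ := h.exists_equiv_pair
  have adj := fun {i j i' j' : Fin 6}
      (h : FWLIndist (FeaturedGraph.plain twoTriangles dn de dg)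
        (FeaturedGraph.plain hexagon dn de dg) i j i' j') =>
    (tupleInput_pair_eq_iff.1 (atomicType_pair_eq_iff.1 h.init).1).2.2.2.1
  have no_triangle : ∀ a b c, hexagon.Adj a b → hexagon.Adj a c → ¬ hexagon.Adj c b := by decide
  exact no_triangle _ _ _ ((adj h).1 (by decide : twoTriangles.Adj 0 1))
    ((adj (hσ 2).1).1 (by decide : twoTriangles.Adj 0 2))
    ((adj (hσ 2).2).1 (by decide : twoTriangles.Adj 2 1))

theorem not_oneWLDistinguishes_twoTriangles_hexagon :
    ¬ OneWLDistinguishes (FeaturedGraph.plain twoTriangles dn de dg)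
      (FeaturedGraph.plain hexagon dn de dg) :=
  not_oneWLDistinguishes_of_regular (r := 2) (fun i => by revert i; decide)
    (fun i => by revert i; decide) rfl

end Strict

/-! ### Interpolation by shallow networks -/

section Interpolation

/-- Some functional vanishes on none of the finitely many nonzero differences. -/
theorem exists_injective_dotProduct {T ι : Type*} [Finite T] [Fintype ι] {x : T → ι → ℝ}
    (hx : Function.Injective x) : ∃ w : ι → ℝ, Function.Injective fun t => w ⬝ᵥ x t := by
  classical
  obtain ⟨f, hf⟩ := Module.exists_dual_forall_apply_ne_zero (K := ℝ)
    (fun p : {p : T × T // p.1 ≠ p.2} => x p.1.1 - x p.1.2)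
    (fun p => sub_ne_zero.2 fun h => p.2 (hx h))
  have hfw : ∀ y : ι → ℝ, f y = (fun i => f fun j => if i = j then 1 else 0) ⬝ᵥ y := by
    intro y
    rw [LinearMap.pi_apply_eq_sum_univ f y]
    simp [dotProduct, mul_comm]
  refine ⟨fun i => f fun j => if i = j then 1 else 0, fun s t hst => ?_⟩
  by_contra hne
  refine hf ⟨(s, t), hne⟩ ?_
  rw [map_sub, hfw, hfw, sub_eq_zero]
  exact hst

/-- The hat function of width `δ`, as a combination of rectifiers. -/
theorem hat_eq {δ u : ℝ} (hδ : 0 < δ) (hu : u = 0 ∨ δ ≤ |u|) :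
    max 0 (u + δ) - 2 * max 0 u + max 0 (u - δ) = if u = 0 then δ else 0 := by
  rcases hu with rfl | hu
  · simp [hδ.le]
  · have hu0 : u ≠ 0 := by
      rintro rfl
      rw [abs_zero] at hu
      linarith
    rw [if_neg hu0]
    rcases le_abs.1 hu with h | h
    · rw [max_eq_right (by linarith), max_eq_right (by linarith), max_eq_right (by linarith)]
      ring
    · rw [max_eq_left (by linarith), max_eq_left (by linarith), max_eq_left (by linarith)]
      ring

theorem exists_separation {T : Type*} [Finite T] {s : T → ℝ} (hs : Function.Injective s) :
    ∃ δ > 0, ∀ t t', t ≠ t' → δ ≤ |s t - s t'| := by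
  classical
  cases nonempty_fintype T
  rcases isEmpty_or_nonempty {p : T × T // p.1 ≠ p.2} with h | h
  · exact ⟨1, one_pos, fun t t' hne => isEmptyElim (⟨(t, t'), hne⟩ : {p : T × T // p.1 ≠ p.2})⟩
  · obtain ⟨p, hp⟩ := Finite.exists_min fun p : {p : T × T // p.1 ≠ p.2} => |s p.1.1 - s p.1.2|
    exact ⟨_, abs_pos.2 (sub_ne_zero.2 fun h => p.2 (hs h)), fun t t' hne => hp ⟨(t, t'), hne⟩⟩

/-- A network with one hidden layer of rectifiers interpolates any function on finitely many
points. -/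
theorem exists_interpolation {T ι : Type*} [Finite T] [Fintype ι] {n : ℕ} {x : T → ι → ℝ}
    (hx : Function.Injective x) (y : T → Vec n) :
    ∃ (m : ℕ) (A : Matrix (Fin m) ι ℝ) (b : Vec m) (A' : Matrix (Fin n) (Fin m) ℝ),
      ∀ t, A' *ᵥ relu (A *ᵥ x t + b) = y t := by
  classical
  cases nonempty_fintype T
  obtain ⟨w, hw⟩ := exists_injective_dotProduct hx
  obtain ⟨δ, hδ, hsep⟩ := exists_separation hw
  -- Three hidden units for each point form a hat function around its projection `w ⬝ᵥ x t`; width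
  -- `δ` makes it vanish at all other points.
  let e := Fintype.equivFin (T × Fin 3)
  refine ⟨_, fun _ i => w i,
    fun k => -(w ⬝ᵥ x (e.symm k).1) + ![δ, 0, -δ] (e.symm k).2,
    fun r k => y (e.symm k).1 r * ![1 / δ, -2 / δ, 1 / δ] (e.symm k).2, fun t => ?_⟩
  funext r
  have : ∀ k, (relu ((fun _ i => w i : Matrix (Fin (Fintype.card (T × Fin 3))) ι ℝ) *ᵥ x t +
      fun k => -(w ⬝ᵥ x (e.symm k).1) + ![δ, 0, -δ] (e.symm k).2)) k =
      max 0 (w ⬝ᵥ x t + (-(w ⬝ᵥ x (e.symm k).1) + ![δ, 0, -δ] (e.symm k).2)) := fun _ => rfl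
  simp only [Matrix.mulVec, dotProduct] at this ⊢
  simp only [this]
  rw [e.symm.sum_comp fun k => y k.1 r * ![1 / δ, -2 / δ, 1 / δ] k.2 *
    max 0 (∑ i, w i * x t i + (-(∑ i, w i * x k.1 i) + ![δ, 0, -δ] k.2)),
    Fintype.sum_prod_type]
  have hat : ∀ t', ∑ a : Fin 3, y t' r * ![1 / δ, -2 / δ, 1 / δ] a *
      max 0 (∑ i, w i * x t i + (-(∑ i, w i * x t' i) + ![δ, 0, -δ] a)) =
      if t = t' then y t' r else 0 := by
    intro t'
    have h := hat_eq (u := w ⬝ᵥ x t - w ⬝ᵥ x t') hδ (by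
      rcases eq_or_ne t t' with rfl | hne
      · left; ring
      · right; exact hsep _ _ hne)
    have hiff : w ⬝ᵥ x t - w ⬝ᵥ x t' = 0 ↔ t = t' := sub_eq_zero.trans hw.eq_iff
    simp only [hiff] at h
    simp only [dotProduct] at h
    rw [Fin.sum_univ_three]
    simp only [Matrix.cons_val]
    calc _ = y t' r / δ * (max 0 (∑ i, w i * x t i - ∑ i, w i * x t' i + δ) -
          2 * max 0 (∑ i, w i * x t i - ∑ i, w i * x t' i) +
          max 0 (∑ i, w i * x t i - ∑ i, w i * x t' i - δ)) := by
            rw [show ∑ i, w i * x t i + (-∑ i, w i * x t' i + δ) =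
              ∑ i, w i * x t i - ∑ i, w i * x t' i + δ by ring,
              show ∑ i, w i * x t i + (-∑ i, w i * x t' i + 0) =
              ∑ i, w i * x t i - ∑ i, w i * x t' i by ring,
              show ∑ i, w i * x t i + (-∑ i, w i * x t' i + -δ) =
              ∑ i, w i * x t i - ∑ i, w i * x t' i - δ by ring]
            ring
      _ = _ := by
            rw [h]
            split_ifs
            · field_simp
            · ring
  simp only [hat, Finset.sum_ite_eq, Finset.mem_univ, if_true]

theorem exists_mlp {T : Type*} {ι : Type} [Finite T] [Fintype ι] {n : ℕ} (x : T → ι → ℝ)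
    (f : (ι → ℝ) → Vec n) : ∃ M : MLP n ι, ∀ t, M.eval (x t) = f (x t) := by
  obtain ⟨m, A, b, A', h⟩ := exists_interpolation (T := Set.range x) Subtype.val_injective
    fun y => f y
  refine ⟨.layer A b (.affine A' 0), fun t => ?_⟩
  simpa [MLP.eval] using h ⟨x t, t, rfl⟩

end Interpolation

/-! ### Normalisations -/

section Normalisation

variable {d : ℕ}

theorem variance_pos {x : Vec d} {o z : Fin d} (ho : x o = 1) (hz : x z = 0) (μ : ℝ) :
    0 < (∑ j, (x j - μ) ^ 2) / d := by
  have hd : 0 < (d : ℝ) := by exact_mod_cast o.pos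
  refine div_pos ?_ hd
  by_contra hc
  have h0 := (Finset.sum_eq_zero_iff_of_nonneg fun j _ => sq_nonneg (x j - μ)).1
    (le_antisymm (not_lt.1 hc) (Finset.sum_nonneg fun j _ => sq_nonneg _))
  have h₁ := pow_eq_zero_iff (two_ne_zero) |>.1 (h0 o (Finset.mem_univ _))
  have h₂ := pow_eq_zero_iff (two_ne_zero) |>.1 (h0 z (Finset.mem_univ _))
  linarith

theorem meanSquare_pos {x : Vec d} {o : Fin d} (ho : x o = 1) : 0 < (∑ j, (x j) ^ 2) / d := by
  have hd : 0 < (d : ℝ) := by exact_mod_cast o.pos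
  refine div_pos (lt_of_lt_of_le one_pos ?_) hd
  calc (1 : ℝ) = (x o) ^ 2 := by rw [ho, one_pow]
    _ ≤ _ := Finset.single_le_sum (fun j _ => sq_nonneg (x j)) (Finset.mem_univ o)

/-- On vectors with an entry `1` and an entry `0` in fixed places, no normalisation loses
information. -/
theorem Config.blockNorm_injOn (cfg : Config) {o z : Fin d} :
    Set.InjOn (cfg.blockNorm ⟨1, 0⟩) {x : Vec d | x o = 1 ∧ x z = 0} := by
  rintro x ⟨hxo, hxz⟩ y ⟨hyo, hyz⟩ hxy
  rcases cfg with ⟨nk, ck, ε, hε⟩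
  cases nk with
  | qk => exact hxy
  | rms =>
    have hs := Real.sqrt_pos.2 (add_pos_of_pos_of_nonneg (meanSquare_pos hxo) hε)
    have ht := Real.sqrt_pos.2 (add_pos_of_pos_of_nonneg (meanSquare_pos hyo) hε)
    have h : ∀ i, x i / Real.sqrt ((∑ j, (x j) ^ 2) / d + ε) =
        y i / Real.sqrt ((∑ j, (y j) ^ 2) / d + ε) := by
      intro i
      simpa [Config.blockNorm, rmsNorm] using congrFun hxy i
    generalize Real.sqrt ((∑ j, (x j) ^ 2) / d + ε) = s at *
    generalize Real.sqrt ((∑ j, (y j) ^ 2) / d + ε) = t at *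
    have hst : s = t := by
      have := h o
      rw [hxo, hyo] at this
      field_simp at this
      exact this.symm
    subst hst
    funext i
    exact (div_left_inj' hs.ne').1 (h i)
  | layer =>
    have hs := Real.sqrt_pos.2 (add_pos_of_pos_of_nonneg
      (variance_pos hxo hxz ((∑ j, x j) / d)) hε)
    have ht := Real.sqrt_pos.2 (add_pos_of_pos_of_nonneg
      (variance_pos hyo hyz ((∑ j, y j) / d)) hε)
    have h : ∀ i, (x i - (∑ j, x j) / d) /
          Real.sqrt ((∑ j, (x j - (∑ j, x j) / d) ^ 2) / d + ε) =
        (y i - (∑ j, y j) / d) / Real.sqrt ((∑ j, (y j - (∑ j, y j) / d) ^ 2) / d + ε) := by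
      intro i
      simpa [Config.blockNorm, layerNorm] using congrFun hxy i
    generalize Real.sqrt ((∑ j, (x j - (∑ j, x j) / d) ^ 2) / d + ε) = s at *
    generalize Real.sqrt ((∑ j, (y j - (∑ j, y j) / d) ^ 2) / d + ε) = t at *
    generalize (∑ j, x j) / (d : ℝ) = μ at *
    generalize (∑ j, y j) / (d : ℝ) = ν at *
    -- Subtracting the coordinate `z`, where both vectors vanish, removes the means; the coordinate
    -- `o` then identifies the scales.
    have h' : ∀ i, x i / s = y i / t := by
      intro i
      have h₁ := h i
      have h₂ := h z
      rw [hxz, hyz] at h₂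
      rw [sub_div, sub_div] at h₁ h₂
      simp only [zero_div, zero_sub, neg_inj] at h₂
      linarith
    have hst : s = t := by
      have := h' o
      rw [hxo, hyo] at this
      field_simp at this
      exact this.symm
    subst hst
    funext i
    exact (div_left_inj' hs.ne').1 (h' i)

/-- Every normalisation can be made to act as the identity on the `0`-`1`-vectors with a given
number of ones. -/
theorem Config.exists_blockNorm_eq_self (cfg : Config) (o z : Fin d) (r : ℝ) :
    ∃ P : NormParams d, ∀ x : Vec d, (∀ i, x i ^ 2 = x i) → ∑ i, x i = r → x o = 1 → x z = 0 →
      cfg.blockNorm P x = x := by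
  rcases cfg with ⟨nk, ck, ε, hε⟩
  cases nk with
  | qk => exact ⟨⟨1, 0⟩, fun _ _ _ _ _ => rfl⟩
  | rms =>
    refine ⟨⟨fun _ => Real.sqrt (r / d + ε), 0⟩, fun x hx hr ho _ => ?_⟩
    have hs := Real.sqrt_pos.2 (add_pos_of_pos_of_nonneg (meanSquare_pos ho) hε)
    simp only [hx, hr] at hs
    funext i
    simp only [Config.blockNorm, rmsNorm, hx, hr]
    field_simp
  | layer =>
    -- Gain and offset undo the normalisation: mean `r / d` and variance are common to all these
    -- vectors, as `x i ^ 2 = x i` makes the sum of squares `r`.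
    refine ⟨⟨fun _ => Real.sqrt ((r - 2 * (r / d) * r + d * (r / d) ^ 2) / d + ε),
      fun _ => r / d⟩, fun x hx hr ho hz => ?_⟩
    have hs := Real.sqrt_pos.2 (add_pos_of_pos_of_nonneg (variance_pos ho hz (r / d)) hε)
    have hv : ∑ j, (x j - r / d) ^ 2 = r - 2 * (r / d) * r + d * (r / d) ^ 2 := by
      have : ∀ j, (x j - r / d) ^ 2 = x j - 2 * (r / d) * x j + (r / d) ^ 2 := fun j => by
        rw [sub_sq, hx]; ring
      simp only [this, Finset.sum_add_distrib, Finset.sum_sub_distrib, ← Finset.mul_sum, hr]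
      simp
    rw [hv] at hs
    funext i
    simp only [Config.blockNorm, layerNorm, hr, hv]
    rw [mul_div_cancel₀ _ hs.ne']
    ring

/-- For `ε = 0` this uses the convention `0 / 0 = 0`. -/
theorem Config.headNorm_zero (cfg : Config) (g : Vec d) : cfg.headNorm ⟨g, 0⟩ 0 = 0 := by
  rcases cfg with ⟨nk, ck, ε, hε⟩
  cases nk with
  | qk => funext i; simp [Config.headNorm, layerNorm]
  | _ => rfl

theorem Config.headNorm_const (cfg : Config) (x : Vec d) : cfg.headNorm ⟨0, x⟩ x = x := by
  rcases cfg with ⟨nk, ck, ε, hε⟩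
  cases nk with
  | qk => funext i; simp [Config.headNorm, layerNorm]
  | _ => rfl

/-- A second index forces `d ≥ 2`, so the mean `1 / d` lies below the entry `1`. -/
theorem Config.headNorm_single_pos (cfg : Config) {o z : Fin d} (hoz : o ≠ z) :
    0 < cfg.headNorm ⟨1, 0⟩ (Pi.single o 1) o := by
  rcases cfg with ⟨nk, ck, ε, hε⟩
  cases nk with
  | qk =>
    have hs := Real.sqrt_pos.2 (add_pos_of_pos_of_nonneg
      (variance_pos (x := Pi.single o 1) (Pi.single_eq_same o 1)
        (Pi.single_eq_of_ne hoz.symm 1) ((∑ j, (Pi.single o 1 : Vec d) j) / d)) hε)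
    have hd : (1 : ℝ) < d := by
      have : 1 < d := by
        by_contra h
        apply hoz
        ext
        omega
      exact_mod_cast this
    simp only [Config.headNorm, layerNorm, Pi.one_apply, one_mul, Pi.zero_apply, add_zero]
    refine div_pos ?_ hs
    simp only [Finset.sum_pi_single', Pi.single_eq_same, Finset.mem_univ, if_true]
    rw [sub_pos, div_lt_one (by linarith)]
    exact hd
  | _ => simp [Config.headNorm]

end Normalisation

/-! ### Encoding of colours -/

section Encoding

variable {m : ℕ}

/-- The coordinate of a relationship vector at position `a` of the first row. -/
def slot (a : Fin (m + 3)) : Fin ((m + 3) * (m + 3)) :=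
  ⟨a, a.2.trans_le (Nat.le_mul_of_pos_left _ (Nat.succ_pos _))⟩

theorem slot_injective : Function.Injective (slot (m := m)) := fun a b h => by
  ext; simpa [slot] using h

/-- The coordinate of a colour. -/
abbrev colorSlot (c : Fin m) : Fin (m + 3) := Fin.castAdd 3 c

/-- Three additional coordinates. -/
abbrev extraSlot (a : Fin 3) : Fin (m + 3) := Fin.natAdd m a

theorem colorSlot_ne_extraSlot (c : Fin m) (a : Fin 3) : colorSlot c ≠ extraSlot a := by
  intro h
  have := congrArg Fin.val h
  simp only [Fin.val_castAdd, Fin.val_natAdd] at this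
  omega

theorem slot_color_ne_extra (c : Fin m) (a : Fin 3) : slot (colorSlot c) ≠ slot (extraSlot a) :=
  fun h => colorSlot_ne_extraSlot c a (slot_injective h)

theorem slot_extra_inj {a b : Fin 3} : slot (m := m) (extraSlot a) = slot (extraSlot b) ↔ a = b :=
  ⟨fun h => by
    have := congrArg Fin.val (slot_injective h)
    simp only [Fin.val_natAdd] at this
    ext; omega, fun h => h ▸ rfl⟩

theorem slot_color_inj {a b : Fin m} : slot (colorSlot a) = slot (colorSlot b) ↔ a = b :=
  ⟨fun h => by simpa using slot_injective h, fun h => h ▸ rfl⟩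

/-- The vector that represents the colour `c`: a one-hot code, an entry that is always `1`, and
entries that are always `0`. -/
def enc (c : Fin m) : Vec ((m + 3) * (m + 3)) :=
  Pi.single (slot (extraSlot 0)) 1 + Pi.single (slot (colorSlot c)) 1

theorem enc_color (c c' : Fin m) : enc c (slot (colorSlot c')) = if c' = c then 1 else 0 := by
  simp [enc, Pi.single_apply, slot_color_ne_extra, slot_color_inj]

theorem enc_extra (c : Fin m) (a : Fin 3) :
    enc c (slot (extraSlot a)) = if a = 0 then 1 else 0 := by
  simp [enc, Pi.single_apply, (slot_color_ne_extra c a).symm, slot_extra_inj]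

theorem enc_injective : Function.Injective (enc (m := m)) := fun c c' h => by
  have := congrFun h (slot (colorSlot c))
  rw [enc_color, enc_color, if_pos rfl] at this
  by_contra hne
  simp [hne] at this

theorem enc_sq (c : Fin m) (i) : enc c i ^ 2 = enc c i := by
  have := slot_color_ne_extra c 0
  simp only [enc, Pi.add_apply, Pi.single_apply]
  split_ifs with h₁ h₂ <;> simp_all

theorem sum_enc (c : Fin m) : ∑ i, enc c i = 2 := by
  simp only [enc, Pi.add_apply, Finset.sum_add_distrib, Finset.sum_pi_single', Finset.mem_univ,
    if_true]
  norm_num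

/-- The linear map that takes the code of each colour `c` to `f c`. -/
def ofColor {n : ℕ} (f : Fin m → Vec n) : Matrix (Fin n) (Fin ((m + 3) * (m + 3))) ℝ :=
  Matrix.of fun r i => ∑ c, if i = slot (colorSlot c) then f c r else 0

theorem ofColor_mulVec {n : ℕ} (f : Fin m → Vec n) (c : Fin m) : ofColor f *ᵥ enc c = f c := by
  funext r
  simp only [Matrix.mulVec, dotProduct, ofColor, Matrix.of_apply, Finset.sum_mul, ite_mul, zero_mul]
  rw [Finset.sum_comm]
  simp [enc_color]

end Encoding

/-! ### Attention that counts coloured paths -/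

section Attention

variable {m : ℕ}

/-- The result of attention, with weights and values depending on the colours of the two segments of
a path, where there are `N a b` paths with colours `a` and `b`. -/
def attnOut {d : ℕ} (N : Fin m → Fin m → ℕ) (S : Fin m → Fin m → ℝ) (F : Fin m → Fin m → Vec d) :
    Vec d :=
  fun r => (∑ a, ∑ b, N a b • (Real.exp (S a b) * F a b r)) / ∑ a, ∑ b, N a b • Real.exp (S a b)

theorem attnOut_uniform_row {n : ℕ} {N : Fin m → Fin m → ℕ} (hN : ∑ a, ∑ b, N a b = n)
    {S : Fin m → Fin m → ℝ} (hS : ∀ a b, S a b = 0) {F : Fin m → Fin m → Vec (m + 3)}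
    (r : Fin (m + 3)) : attnOut N S F r = (∑ a, ∑ b, (N a b : ℝ) * F a b r) / n := by
  simp only [attnOut, hS, Real.exp_zero, nsmul_eq_mul, mul_one, one_mul]
  congr 1
  exact_mod_cast hN

/-- Parameters of attention by which the result determines the numbers of paths. -/
theorem Config.exists_countingAttention (cfg : Config) (m : ℕ) :
    ∃ (PQ PK : NormParams (m + 3))
      (Q : Fin (m + 3) → Matrix (Fin (m + 3)) (Fin ((m + 3) * (m + 3))) ℝ)
      (K V : Fin 2 → Fin (m + 3) → Matrix (Fin (m + 3)) (Fin ((m + 3) * (m + 3))) ℝ)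
      (S : Fin (m + 3) → Fin m → Fin m → ℝ) (F : Fin (m + 3) → Fin m → Fin m → Vec (m + 3)),
      (∀ i c a b, (cfg.headNorm PQ (Q i *ᵥ enc c) ⬝ᵥ cfg.combineTwo
        (cfg.headNorm PK (K 1 i *ᵥ enc a)) (cfg.headNorm PK (K 0 i *ᵥ enc b))) /
          Real.sqrt ((m + 3 : ℕ) : ℝ) = S i a b) ∧
      (∀ i a b, cfg.combineTwo (V 1 i *ᵥ enc a) (V 0 i *ᵥ enc b) = F i a b) ∧
      ∀ (n : ℕ) (N N' : Fin m → Fin m → ℕ), n ≠ 0 → ∑ a, ∑ b, N a b = n →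
        ∑ a, ∑ b, N' a b = n → (∀ i, attnOut N (S i) (F i) = attnOut N' (S i) (F i)) → N = N' := by
  rcases hcfg : cfg.combine with _ | _
  -- Addition: heads `extraSlot 0` and `extraSlot 1` attend uniformly and give the row sums `R a`
  -- and column sums `C b`. Head `colorSlot b` gives weight `exp L = 1 + κ` to pivots whose second
  -- segment has colour `b`, so its entry `a` is `(R a + κ * N a b) / (n + κ * C b)`, which
  -- determines `N a b`.
  · let x := cfg.headNorm (d := m + 3) ⟨1, 0⟩ (Pi.single (extraSlot 0) 1)
    have hx : 0 < x (extraSlot 0) :=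
      cfg.headNorm_single_pos (z := extraSlot 1) (by simp [extraSlot])
    let L : ℝ := x (extraSlot 0) / Real.sqrt ((m + 3 : ℕ) : ℝ)
    have hL : 0 < L := div_pos hx (Real.sqrt_pos.2 (by positivity))
    let κ := Real.exp L - 1
    have hκ : 0 < κ := sub_pos.2 (Real.one_lt_exp_iff.2 hL)
    refine ⟨⟨0, Pi.single (extraSlot 0) 1⟩, ⟨1, 0⟩,
      fun _ => ofColor fun _ => Pi.single (extraSlot 0) 1,
      ![fun i => ofColor fun c => if i = colorSlot c then Pi.single (extraSlot 0) 1 else 0,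
        fun _ => ofColor fun _ => 0],
      ![fun i => ofColor fun c => if i = extraSlot 1 then Pi.single (colorSlot c) 1 else 0,
        fun i => ofColor fun c => if i = extraSlot 1 then 0 else Pi.single (colorSlot c) 1],
      fun i _ b => if i = colorSlot b then L else 0,
      fun i a b => Pi.single (colorSlot (if i = extraSlot 1 then b else a)) 1, ?_, ?_, ?_⟩
    · intro i c a b
      simp only [ofColor_mulVec, Matrix.cons_val_zero, Matrix.cons_val_one, Config.combineTwo, hcfg,
        cfg.headNorm_zero, cfg.headNorm_const, zero_add, single_one_dotProduct]
      split_ifs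
      · rfl
      · rw [cfg.headNorm_zero]; simp
    · intro i a b
      simp only [ofColor_mulVec, Matrix.cons_val_zero, Matrix.cons_val_one, Config.combineTwo, hcfg]
      split_ifs <;> simp
    · intro n N N' hn hN hN' h
      have hn' : (n : ℝ) ≠ 0 := Nat.cast_ne_zero.2 hn
      have row : ∀ (N : Fin m → Fin m → ℕ) (a : Fin m),
          ∑ a', ∑ b, (N a' b : ℝ) * (Pi.single (colorSlot a') 1 : Vec (m + 3)) (colorSlot a) =
            ∑ b, (N a b : ℝ) := by
        intro N a
        simp [Pi.single_apply]
      have hrow : ∀ a, ∑ b, (N a b : ℝ) = ∑ b, (N' a b : ℝ) := by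
        intro a
        have := congrFun (h (extraSlot 0)) (colorSlot a)
        rw [attnOut_uniform_row hN, attnOut_uniform_row hN', div_left_inj' hn'] at this
        · simpa [extraSlot, row] using this
        · exact fun a b => if_neg (colorSlot_ne_extraSlot _ _).symm
        · exact fun a b => if_neg (colorSlot_ne_extraSlot _ _).symm
      have hcol : ∀ b, ∑ a, (N a b : ℝ) = ∑ a, (N' a b : ℝ) := by
        intro b
        have := congrFun (h (extraSlot 1)) (colorSlot b)
        rw [attnOut_uniform_row hN, attnOut_uniform_row hN', div_left_inj' hn'] at this
        · simpa [Pi.single_apply] using this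
        · exact fun a b => if_neg (colorSlot_ne_extraSlot _ _).symm
        · exact fun a b => if_neg (colorSlot_ne_extraSlot _ _).symm
      have hexp : ∀ b b' : Fin m, Real.exp (if colorSlot b = colorSlot b' then L else 0) =
          1 + κ * if b = b' then 1 else 0 := by
        intro b b'
        by_cases hb : b = b' <;> simp [hb, κ]
      have hden : ∀ N : Fin m → Fin m → ℕ, ∀ b, ∑ a, ∑ b', N a b' •
          Real.exp (if colorSlot b = colorSlot b' then L else 0) =
            ∑ a, ∑ b', (N a b' : ℝ) + κ * ∑ a, (N a b : ℝ) := by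
        intro N b
        simp only [hexp, nsmul_eq_mul, mul_add, mul_one, Finset.sum_add_distrib]
        congr 1
        simp [← Finset.sum_mul, mul_comm]
      have hnum : ∀ N : Fin m → Fin m → ℕ, ∀ a b, ∑ a', ∑ b', N a' b' •
          (Real.exp (if colorSlot b = colorSlot b' then L else 0) *
            (Pi.single (colorSlot (if colorSlot b = extraSlot 1 then b' else a')) 1 : Vec (m + 3))
              (colorSlot a)) = ∑ b', (N a b' : ℝ) + κ * N a b := by
        intro N a b
        simp only [if_neg (colorSlot_ne_extraSlot b 1), hexp, nsmul_eq_mul]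
        rw [Finset.sum_eq_single a]
        · simp [mul_add, Finset.sum_add_distrib, mul_comm]
        · intro a' _ ha'
          simp [ha'.symm]
        · simp
      funext a b
      have := congrFun (h (colorSlot b)) (colorSlot a)
      simp only [attnOut, hden, hnum] at this
      have e₁ : ∑ a, ∑ b, (N a b : ℝ) = n := by exact_mod_cast hN
      have e₂ : ∑ a, ∑ b, (N' a b : ℝ) = n := by exact_mod_cast hN'
      rw [e₁, e₂, hrow, hcol] at this
      have hpos : (n : ℝ) + κ * ∑ a, (N' a b : ℝ) ≠ 0 := by positivity
      rw [div_left_inj' hpos, add_right_inj, mul_right_inj' hκ.ne'] at this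
      exact_mod_cast this
  -- Multiplication: all scores vanish, and head `colorSlot a` masks the one-hot code of the second
  -- segment by whether the first has colour `a`. Its entry `b` is `N a b / n`.
  · refine ⟨⟨1, 0⟩, ⟨1, 0⟩, fun _ => ofColor fun _ => 0,
      ![fun _ => ofColor fun _ => 0, fun _ => ofColor fun _ => 0],
      ![fun _ => ofColor fun c => Pi.single (colorSlot c) 1,
        fun i => ofColor fun c _ => if i = colorSlot c then 1 else 0],
      fun _ _ _ => 0,
      fun i a b r => (if i = colorSlot a then 1 else 0) *
        (Pi.single (colorSlot b) 1 : Vec (m + 3)) r, ?_, ?_, ?_⟩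
    · intro i c a b
      simp only [ofColor_mulVec, cfg.headNorm_zero, zero_dotProduct, zero_div]
    · intro i a b
      simp only [ofColor_mulVec, Matrix.cons_val_zero, Matrix.cons_val_one, Config.combineTwo, hcfg]
      rfl
    · intro n N N' hn hN hN' h
      have hn' : (n : ℝ) ≠ 0 := Nat.cast_ne_zero.2 hn
      have entry : ∀ (N : Fin m → Fin m → ℕ) (a b : Fin m),
          ∑ a', ∑ b', (N a' b' : ℝ) * ((if colorSlot a = colorSlot a' then 1 else 0) *
            (Pi.single (colorSlot b') 1 : Vec (m + 3)) (colorSlot b)) = N a b := by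
        intro N a b
        rw [Finset.sum_eq_single a, Finset.sum_eq_single b]
        · simp
        · intro b' _ hb'
          simp [hb'.symm]
        · simp
        · intro a' _ ha'
          simp [ha'.symm]
        · simp
      funext a b
      have := congrFun (h (colorSlot a)) (colorSlot b)
      rw [attnOut_uniform_row hN fun _ _ => rfl, attnOut_uniform_row hN' fun _ _ => rfl,
        div_left_inj' hn', entry, entry] at this
      exact_mod_cast this

/-- The number of paths `i ⇝ p ⇝ j` with colours `a` and `b`. -/
def pathCount {V : Type u} [Fintype V] (c : V → V → Fin m) (i j : V) (a b : Fin m) : ℕ :=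
  (Finset.univ.filter fun p => c i p = a ∧ c p j = b).card

/-- Groups pivots by their pair of colours. General `M` covers real sums in attention as well as
multisets of colours. -/
theorem sum_pathCount_smul {V : Type u} [Fintype V] {M : Type*} [AddCommMonoid M]
    (c : V → V → Fin m) (i j : V) (g : Fin m → Fin m → M) :
    ∑ a, ∑ b, pathCount c i j a b • g a b = ∑ p, g (c i p) (c p j) := by
  classical
  simp only [pathCount, Finset.card_eq_sum_ones, Finset.sum_smul, Finset.sum_filter]
  rw [Finset.sum_congr rfl fun a _ => Finset.sum_comm, Finset.sum_comm]
  refine Finset.sum_congr rfl fun p _ => ?_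
  simp only [ite_and]
  simp

theorem sum_pathCount {V : Type u} [Fintype V] (c : V → V → Fin m) (i j : V) :
    ∑ a, ∑ b, pathCount c i j a b = Fintype.card V := by
  simpa [-smul_eq_mul, nsmul_eq_mul] using sum_pathCount_smul c i j fun _ _ => (1 : ℕ)

theorem attend_eq_attnOut {V : Type u} [Fintype V] {d : ℕ} (c : V → V → Fin m) (i j : V) {q : Vec d}
    {key val : V → Vec d} {S : Fin m → Fin m → ℝ} {F : Fin m → Fin m → Vec d}
    (hS : ∀ p, (q ⬝ᵥ key p) / Real.sqrt d = S (c i p) (c p j))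
    (hF : ∀ p, val p = F (c i p) (c p j)) :
    attend q key val = attnOut (pathCount c i j) S F := by
  funext r
  simp only [attend, hS, hF, attnOut, sum_pathCount_smul]
  rw [Finset.sum_apply, Finset.sum_div]
  exact Finset.sum_congr rfl fun p _ => by
    simp only [Pi.smul_apply, smul_eq_mul]; ring

end Attention

/-! ### A block that computes one round of refinement -/

section Blocks

variable {m : ℕ}

theorem Block.pairApply_enc {V : Type u} [Fintype V] (cfg : Config)
    (B : Block 2 (m + 3) (m + 3)) {S : Fin (m + 3) → Fin m → Fin m → ℝ}
    {F : Fin (m + 3) → Fin m → Fin m → Vec (m + 3)} {Φ : Fin m → (Fin m → Fin m → ℕ) → Fin m}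
    (hnorm : ∀ c : Fin m, cfg.blockNorm B.normAttention (enc c) = enc c)
    (hS : ∀ i c a b, (cfg.headNorm B.normQuery (B.query i *ᵥ enc c) ⬝ᵥ cfg.combineTwo
        (cfg.headNorm B.normKey (B.key 1 i *ᵥ enc a))
        (cfg.headNorm B.normKey (B.key 0 i *ᵥ enc b))) / Real.sqrt ((m + 3 : ℕ) : ℝ) = S i a b)
    (hF : ∀ i a b, cfg.combineTwo (B.value 1 i *ᵥ enc a) (B.value 0 i *ᵥ enc b) = F i a b)
    (hB : ∀ (c : Fin m) (N : Fin m → Fin m → ℕ), ∑ a, ∑ b, N a b = Fintype.card V →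
      enc c + B.output *ᵥ (fun i => attnOut N (S i.1) (F i.1) i.2) +
        B.feedForward (cfg.blockNorm B.normFeedForward
          (enc c + B.output *ᵥ (fun i => attnOut N (S i.1) (F i.1) i.2))) = enc (Φ c N))
    (c : V → V → Fin m) :
    B.pairApply cfg (fun i j => enc (c i j)) =
      fun i j => enc (Φ (c i j) (pathCount c i j)) := by
  funext i j
  have hatt : B.pairAttention cfg (fun i j => enc (c i j)) i j =
      B.output *ᵥ fun hc => attnOut (pathCount c i j) (S hc.1) (F hc.1) hc.2 := by
    unfold Block.pairAttention
    congr 1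
    funext hc
    exact congrFun (attend_eq_attnOut c i j (fun p => hS _ _ _ _) fun p => hF _ _ _) hc.2
  rw [← hB _ _ (sum_pathCount c i j)]
  simp only [Block.pairApply, hnorm, hatt]

/-- The map that writes the value of a linear functional into a spare coordinate. -/
def toSpare {ι : Type*} (w : ι → ℝ) : Matrix (Fin ((m + 3) * (m + 3))) ι ℝ :=
  Matrix.of fun r i => if r = slot (extraSlot 2) then w i else 0

theorem toSpare_mulVec {ι : Type*} [Fintype ι] (w x : ι → ℝ) :
    toSpare (m := m) w *ᵥ x = Pi.single (slot (extraSlot 2)) (w ⬝ᵥ x) := by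
  funext r
  by_cases hr : r = slot (extraSlot 2)
  · subst hr; simp [toSpare, Matrix.mulVec, dotProduct]
  · simp [toSpare, Matrix.mulVec, dotProduct, hr]

instance finite_counts (m n : ℕ) :
    Finite {N : Fin m → Fin m → ℕ // ∑ a, ∑ b, N a b = n} := by
  refine Set.Finite.subset (Set.finite_Icc 0 fun _ _ => n) fun N hN => ⟨fun _ _ => Nat.zero_le _,
    fun a b => ?_⟩
  calc N a b ≤ ∑ b, N a b := Finset.single_le_sum (fun _ _ => Nat.zero_le _) (Finset.mem_univ b)
    _ ≤ ∑ a, ∑ b, N a b := Finset.single_le_sum (f := fun a => ∑ b, N a b)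
        (fun _ _ => Nat.zero_le _) (Finset.mem_univ a)
    _ = n := hN

/-- Any function of the colour of a pair and the numbers of coloured paths is computed by a block. -/
theorem exists_block (cfg : Config) (V : Type u) (W : Type v) [Fintype V] [Fintype W]
    [Nonempty V] (hVW : Fintype.card V = Fintype.card W)
    (Φ : Fin m → (Fin m → Fin m → ℕ) → Fin m) :
    ∃ B : Block 2 (m + 3) (m + 3),
      (∀ c : V → V → Fin m, B.pairApply cfg (fun i j => enc (c i j)) =
        fun i j => enc (Φ (c i j) (pathCount c i j))) ∧
      ∀ c : W → W → Fin m, B.pairApply cfg (fun i j => enc (c i j)) =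
        fun i j => enc (Φ (c i j) (pathCount c i j)) := by
  obtain ⟨PQ, PK, Q, K, Va, S, F, hS, hF, hinj⟩ := cfg.exists_countingAttention m
  let n := Fintype.card V
  let out : {N : Fin m → Fin m → ℕ // ∑ a, ∑ b, N a b = n} → Fin (m + 3) × Fin (m + 3) → ℝ :=
    fun N i => attnOut N.1 (S i.1) (F i.1) i.2
  have hout : Function.Injective out := fun N N' h => Subtype.ext <|
    hinj n N.1 N'.1 Fintype.card_ne_zero N.2 N'.2 fun i => funext fun r => congrFun h (i, r)
  -- Only finitely many tables have total `n`, so one number can stand for the whole attention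
  -- output.
  obtain ⟨w, hw⟩ := exists_injective_dotProduct hout
  let x : Fin m × {N : Fin m → Fin m → ℕ // ∑ a, ∑ b, N a b = n} → Vec ((m + 3) * (m + 3)) :=
    fun p => enc p.1 + toSpare w *ᵥ out p.2
  have hxe : ∀ p, x p = enc p.1 + Pi.single (slot (extraSlot 2)) (w ⬝ᵥ out p.2) := fun p => by
    simp only [x, toSpare_mulVec]
  have hx0 : ∀ p, x p (slot (extraSlot 0)) = 1 ∧ x p (slot (extraSlot 1)) = 0 := fun p => by
    simp [hxe, enc_extra, slot_extra_inj]
  have hx : Function.Injective x := by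
    intro p p' h
    have h₁ : ∀ c, x p (slot (colorSlot c)) = x p' (slot (colorSlot c)) := fun c => by rw [h]
    have h₂ : x p (slot (extraSlot 2)) = x p' (slot (extraSlot 2)) := by rw [h]
    simp only [hxe, Pi.add_apply, Pi.single_apply, slot_color_ne_extra, if_false, enc_extra,
      enc_color, add_zero, if_true] at h₁ h₂
    refine Prod.ext ?_ (hw (by simpa using h₂))
    have := h₁ p.1
    by_contra hne
    simp [hne] at this
  have hxn : Function.Injective fun p => cfg.blockNorm ⟨1, 0⟩ (x p) := fun p p' h =>
    hx (cfg.blockNorm_injOn (hx0 p) (hx0 p') h)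
  -- The residual connection adds `x p` back, so the FFN must produce the difference.
  obtain ⟨k, A, b, A', hA⟩ := exists_interpolation hxn fun p => enc (Φ p.1 p.2.1) - x p
  obtain ⟨P, hP⟩ := cfg.exists_blockNorm_eq_self (slot (m := m) (extraSlot 0))
    (slot (extraSlot 1)) 2
  have hnorm : ∀ c : Fin m, cfg.blockNorm P (enc c) = enc c := fun c =>
    hP _ (enc_sq c) (sum_enc c) (by simp [enc_extra]) (by simp [enc_extra])
  let B : Block 2 (m + 3) (m + 3) := ⟨P, ⟨1, 0⟩, PQ, PK, Q, K, Va, toSpare w, k, A, b, A', 0⟩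
  have hB : ∀ (c : Fin m) (N : Fin m → Fin m → ℕ), ∑ a, ∑ b, N a b = n →
      enc c + B.output *ᵥ (fun i => attnOut N (S i.1) (F i.1) i.2) +
        B.feedForward (cfg.blockNorm B.normFeedForward
          (enc c + B.output *ᵥ (fun i => attnOut N (S i.1) (F i.1) i.2))) = enc (Φ c N) := by
    intro c N hN
    have := hA (c, ⟨N, hN⟩)
    change x (c, ⟨N, hN⟩) + B.feedForward (cfg.blockNorm ⟨1, 0⟩ (x (c, ⟨N, hN⟩))) = _
    simp only [Block.feedForward, B, add_zero, this]
    exact add_sub_cancel _ _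
  exact ⟨B, B.pairApply_enc cfg hnorm hS hF hB,
    B.pairApply_enc cfg hnorm hS hF fun c N hN => hB c N (hN.trans hVW.symm)⟩

end Blocks

/-! ### FloydNet computes the refinement -/

section LowerBound

variable {V : Type u} {W : Type v} [Fintype V] [Fintype W] {dn de dg : ℕ}

/-- The code is faithful only on the range of `f`; this keeps the number of codes independent of the
round. -/
theorem exists_code {E X : Type*} [Fintype E] [Nonempty E] (f : E → X) :
    ∃ (code : X → Fin (Fintype.card E)) (dec : Fin (Fintype.card E) → X),
      ∀ e, dec (code (f e)) = f e :=
  ⟨fun x => Fintype.equivFin E (Function.invFun f x), fun a => f ((Fintype.equivFin E).symm a),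
    fun e => by
      simp only [Equiv.symm_apply_apply]
      exact Function.invFun_eq ⟨e, rfl⟩⟩

/-- One round of refinement, computed from codes of colours and the numbers of coloured paths. -/
theorem refine_succ_pair {A : Type} (c : (Fin 2 → V) → A) (t : ℕ) {m : ℕ}
    {code : FWLColor A 2 t → Fin m} {dec : Fin m → FWLColor A 2 t}
    (h : ∀ i j, dec (code (refine c t ![i, j])) = refine c t ![i, j]) (i j : V) :
    refine c (t + 1) ![i, j] = (dec (code (refine c t ![i, j])),
      ∑ a, ∑ b, pathCount (fun i j => code (refine c t ![i, j])) i j a b •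
        ({![dec b, dec a]} : Multiset (Fin 2 → FWLColor A 2 t))) := by
  -- The reversed order `![dec b, dec a]` arises because replacing position `0` of `(i, j)` by `p`
  -- gives the second segment `(p, j)`.
  rw [sum_pathCount_smul, h]
  simp only [h]
  refine Prod.ext rfl ?_
  change Multiset.map _ _ = _
  have hsum : ∑ p, ({![refine c t ![p, j], refine c t ![i, p]]} : Multiset _) =
      Finset.univ.val.map fun p => ![refine c t ![p, j], refine c t ![i, p]] :=
    (congrArg Multiset.sum (Multiset.map_map (fun x => ({x} : Multiset _)) _ _).symm).trans
      (Multiset.sum_map_singleton _)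
  refine (Multiset.map_congr rfl fun p _ => ?_).trans hsum.symm
  funext a
  fin_cases a
  · simp [update_pair_zero]
  · simp [update_pair_one]

/-- For two graphs with equally many vertices, `t` rounds of refinement are computed by a FloydNet
with `t` blocks. -/
theorem exists_net (cfg : Config) (G : FeaturedGraph V dn de dg) (H : FeaturedGraph W dn de dg)
    [Nonempty V] (hVW : Fintype.card V = Fintype.card W) (t : ℕ) :
    ∃ (N : Net 2 dn de dg)
      (read : Vec (N.heads * N.headDim) → FWLColor (InputIndex 2 dn de dg → ℝ) 2 t),
      (∀ i j, read (N.pairRep cfg G i j) = refine (tupleInput G) t ![i, j]) ∧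
      ∀ i j, read (N.pairRep cfg H i j) = refine (tupleInput H) t ![i, j] := by
  let m := Fintype.card (V × V ⊕ W × W)
  have hm : ∀ t, ∃ (code : FWLColor (InputIndex 2 dn de dg → ℝ) 2 t → Fin m)
      (dec : Fin m → FWLColor (InputIndex 2 dn de dg → ℝ) 2 t),
      (∀ i j, dec (code (refine (tupleInput G) t ![i, j])) = refine (tupleInput G) t ![i, j]) ∧
      ∀ i j, dec (code (refine (tupleInput H) t ![i, j])) = refine (tupleInput H) t ![i, j] := by
    intro t
    obtain ⟨code, dec, h⟩ := exists_code (E := V × V ⊕ W × W)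
      (Sum.elim (fun e => refine (tupleInput G) t ![e.1, e.2])
        fun e => refine (tupleInput H) t ![e.1, e.2])
    exact ⟨code, dec, fun i j => h (.inl (i, j)), fun i j => h (.inr (i, j))⟩
  choose code dec hG hH using hm
  have hblocks : ∀ t, ∃ L : List (Block 2 (m + 3) (m + 3)),
      (L.foldl (fun R B => B.pairApply cfg R)
        (fun i j => enc (code 0 (refine (tupleInput G) 0 ![i, j]))) =
          fun i j => enc (code t (refine (tupleInput G) t ![i, j]))) ∧
      L.foldl (fun R B => B.pairApply cfg R)
        (fun i j => enc (code 0 (refine (tupleInput H) 0 ![i, j]))) =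
          fun i j => enc (code t (refine (tupleInput H) t ![i, j])) := by
    intro t
    induction t with
    | zero => exact ⟨[], rfl, rfl⟩
    | succ t ih =>
      obtain ⟨L, hL₁, hL₂⟩ := ih
      -- The update decodes the old colours, forms the refined colour from the path counts, and
      -- encodes it for the next round.
      obtain ⟨B, hB₁, hB₂⟩ := exists_block cfg V W hVW fun a N =>
        code (t + 1) (dec t a, ∑ a, ∑ b, N a b •
          ({![dec t b, dec t a]} : Multiset (Fin 2 → FWLColor _ 2 t)))
      refine ⟨L ++ [B], ?_, ?_⟩
      · rw [List.foldl_append, hL₁, List.foldl_cons, List.foldl_nil, hB₁]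
        funext i j
        rw [← refine_succ_pair _ _ (hG t)]
      · rw [List.foldl_append, hL₂, List.foldl_cons, List.foldl_nil, hB₂]
        funext i j
        rw [← refine_succ_pair _ _ (hH t)]
  obtain ⟨L, hL₁, hL₂⟩ := hblocks t
  obtain ⟨M, hM⟩ := exists_mlp (T := V × V ⊕ W × W)
    (Sum.elim (fun e => tupleInput G ![e.1, e.2]) fun e => tupleInput H ![e.1, e.2])
    fun x => enc (code 0 x)
  have : Nonempty (Fin m) := ⟨Fintype.equivFin (V × V ⊕ W × W) (.inl Classical.ofNonempty)⟩
  refine ⟨⟨m + 3, m + 3, Nat.succ_pos _, Nat.succ_pos _, M, L⟩,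
    fun x => dec t (Function.invFun enc x), fun i j => ?_, fun i j => ?_⟩
  · have h₀ : (fun i j => M.eval (concatInput G.graphFeat (G.nodeFeat i) (G.nodeFeat j)
        (G.pairInput i j))) = fun i j => enc (code 0 (refine (tupleInput G) 0 ![i, j])) := by
      funext i j
      rw [← tupleInput_pair]
      exact hM (.inl (i, j))
    simp only [Net.pairRep, h₀, hL₁]
    rw [Function.leftInverse_invFun enc_injective, hG]
  · have h₀ : (fun i j => M.eval (concatInput H.graphFeat (H.nodeFeat i) (H.nodeFeat j)
        (H.pairInput i j))) = fun i j => enc (code 0 (refine (tupleInput H) 0 ![i, j])) := by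
      funext i j
      rw [← tupleInput_pair]
      exact hM (.inr (i, j))
    simp only [Net.pairRep, h₀, hL₂]
    rw [Function.leftInverse_invFun enc_injective, hH]

theorem inputEquivalent_of_not_floydNetDistinguishes {cfg : Config}
    {G : FeaturedGraph V dn de dg} {H : FeaturedGraph W dn de dg}
    (h : ¬ FloydNetDistinguishes cfg G H) : InputEquivalent G H := by
  simp only [FloydNetDistinguishes, not_exists, not_not] at h
  have hcard : Fintype.card V = Fintype.card W := by
    -- Any network serves here: the sizes of the two multisets are `|V| ^ 2` and `|W| ^ 2`.
    have := congrArg Multiset.card (h ⟨1, 1, one_pos, one_pos, .affine 0 0, []⟩)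
    simp only [Multiset.card_map, Finset.card_val, Finset.card_univ, Fintype.card_prod] at this
    exact Nat.mul_self_inj.1 this
  intro t
  rcases isEmpty_or_nonempty V with hV | hV
  · exact map_univ_eq_of_equiv
      (Fintype.equivOfCardEq (by rw [Fintype.card_fun, Fintype.card_fun, hcard]))
      fun e => isEmptyElim (e 0)
  obtain ⟨N, read, hG, hH⟩ := exists_net cfg G H hcard t
  obtain ⟨τ, hτ⟩ := exists_equiv_of_map_univ_eq (h N)
  refine map_univ_eq_of_equiv (((finTwoArrowEquiv V).trans τ).trans (finTwoArrowEquiv W).symm)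
    fun e => ?_
  have := congrArg read (hτ (e 0, e 1))
  rw [hG, hH] at this
  rw [eq_pair e]
  exact this

theorem floydNetDistinguishes_iff_fwlDistinguishes {cfg : Config}
    {G : FeaturedGraph V dn de dg} {H : FeaturedGraph W dn de dg} :
    FloydNetDistinguishes cfg G H ↔ FWLDistinguishes 2 G H :=
  ⟨FloydNetDistinguishes.fwlDistinguishes, fun h => by
    by_contra hc
    exact (inputEquivalent_of_not_floydNetDistinguishes hc).not_fwlDistinguishes h⟩

theorem OneWLDistinguishes.floydNetDistinguishes {cfg : Config}
    {G : FeaturedGraph V dn de dg} {H : FeaturedGraph W dn de dg} (h : OneWLDistinguishes G H) :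
    FloydNetDistinguishes cfg G H := by
  by_contra hc
  exact (inputEquivalent_of_not_floydNetDistinguishes hc).not_oneWLDistinguishes h

end LowerBound

end FloydNet

end

theorem mainTheorem2 (cfg : FloydNet.Config) (dn de dg : ℕ) :
    (∀ (N : FloydNet.Net 2 dn de dg) (V : Type u) [Fintype V]
        (G : FloydNet.FeaturedGraph V dn de dg) (i j : V),
      N.pairRep cfg G i j = N.tupleRep cfg G ![i, j]) ∧
    (∀ (V : Type u) (W : Type v) [Fintype V] [Fintype W]
        (G : FloydNet.FeaturedGraph V dn de dg) (H : FloydNet.FeaturedGraph W dn de dg),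
      (FloydNet.FloydNetDistinguishes cfg G H ↔ FloydNet.FWLDistinguishes 2 G H) ∧
      (FloydNet.FWLDistinguishes 2 G H ↔ FloydNet.WLDistinguishes 3 G H) ∧
      (FloydNet.FloydNetDistinguishes cfg G H ↔ FloydNet.WLDistinguishes 3 G H) ∧
      (FloydNet.MPNNDistinguishes G H → FloydNet.OneWLDistinguishes G H) ∧
      (FloydNet.OneWLDistinguishes G H → FloydNet.FloydNetDistinguishes cfg G H)) ∧
    (∃ (n : ℕ) (S T : SimpleGraph (Fin n)),
      FloydNet.FloydNetDistinguishes cfg (FloydNet.FeaturedGraph.plain S dn de dg)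
        (FloydNet.FeaturedGraph.plain T dn de dg) ∧
      ¬ FloydNet.OneWLDistinguishes (FloydNet.FeaturedGraph.plain S dn de dg)
        (FloydNet.FeaturedGraph.plain T dn de dg) ∧
      ¬ FloydNet.MPNNDistinguishes (FloydNet.FeaturedGraph.plain S dn de dg)
        (FloydNet.FeaturedGraph.plain T dn de dg)) :=
  ⟨fun N _ _ G i j => N.pairRep_eq_tupleRep cfg G i j,
    fun _ _ _ _ _ _ => ⟨FloydNet.floydNetDistinguishes_iff_fwlDistinguishes,
      FloydNet.fwlDistinguishes_iff_wlDistinguishes,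
      FloydNet.floydNetDistinguishes_iff_fwlDistinguishes.trans
        FloydNet.fwlDistinguishes_iff_wlDistinguishes,
      FloydNet.MPNNDistinguishes.oneWLDistinguishes,
      FloydNet.OneWLDistinguishes.floydNetDistinguishes⟩,
    ⟨6, FloydNet.twoTriangles, FloydNet.hexagon,
      FloydNet.floydNetDistinguishes_iff_fwlDistinguishes.2
        FloydNet.fwlDistinguishes_twoTriangles_hexagon,
      FloydNet.not_oneWLDistinguishes_twoTriangles_hexagon,
      fun h => FloydNet.not_oneWLDistinguishes_twoTriangles_hexagon h.oneWLDistinguishes⟩⟩
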